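/- Let $(p_i)_{i\ge 1}$ be real numbers with $0\le p_i<1/2$ and let $X_0=0,X_1,X_2,\dots$ be a Markov chain on $\{0,1,2,\dots\}$ which from $0$ moves to $1$ with probability $1$, and from $i\ge 1$ moves to $i+1$ with probability $\tfrac12+p_i$ and to $i-1$ with probability $\tfrac12-p_i$. Assume that the chain is transient. Put $U_i=\frac{1/2-p_i}{1/2+p_i}$ for $i\ge1$ and $$D(n)=1+\sum_{j=1}^{\infty}\prod_{i=1}^{j}U_{n+i}=\lim_{N\to\infty}\Bigl(1+\sum_{j=1}^{N-n-1}\prod_{i=1}^{j}U_{n+i}\Bigr),\qquad n\ge 1,$$ which is finite by transience. Call a site $R$ a cutpoint if for some $k\ge 0$ we have $X_k=R$, $X_i\le R$ for all $0\le i\le k$ and $X_i>R$ for all $i>k$; call it a strong cutpoint if for some $k\ge 0$ we have $X_k=R$, $X_i<R$ for all $0\le i<k$ and $X_i>R$ for all $i>k$ (equivalently, almost surely, $R$ is visited exactly once). (a) If $\sum_{n=2}^\infty \frac{1}{D(n)\log n}<\infty$, then almost surely the chain has only finitely many cutpoints. (b) If there are $\delta>0$ and $n_0$ such that $D(n)\le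 \delta\, n\log n$ for all $n\ge n_0$, and $\sum_{n=2}^\infty \frac{1}{D(n)\log n}=\infty$, then almost surely the chain has infinitely many strong cutpoints. -/

import Mathlib

open Filter Topology MeasureTheory

namespace BirthDeath

/-- Upward jump probability `E_i`: reflection at `0`, and `1/2 + p_i` at `i ≥ 1`. -/
noncomputable def E (p : ℕ → ℝ) (i : ℕ) : ℝ := if i = 0 then 1 else 1 / 2 + p i

/-- Transition matrix of the nearest-neighbour walk: up with probability `E_i`, down with
probability `1 - E_i`. -/
noncomputable def step (p : ℕ → ℝ) (i j : ℕ) : ℝ :=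
  if j = i + 1 then E p i else if i = j + 1 then 1 - E p i else 0

/-- `X` is, under `μ`, a time-homogeneous Markov chain on `ℕ` started at `0` with transition
matrix `K`: conditionally on any past `X_0 = x_0, …, X_n = x_n` the next state has law
`K (x_n) ·`. -/
structure IsMarkovChain {Ω : Type*} [MeasurableSpace Ω] (μ : Measure Ω) (K : ℕ → ℕ → ℝ)
    (X : ℕ → Ω → ℕ) : Prop where
  measurable : ∀ n, Measurable (X n)
  start : ∀ᵐ ω ∂μ, X 0 ω = 0
  markov : ∀ (n : ℕ) (x : ℕ → ℕ) (j : ℕ),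
    μ {ω | (∀ i ≤ n, X i ω = x i) ∧ X (n + 1) ω = j} =
      ENNReal.ofReal (K (x n) j) * μ {ω | ∀ i ≤ n, X i ω = x i}

/-- Every state is transient: given that the chain is at `x` at time `m` (an event of positive
probability), the conditional probability of a later return to `x` is less than `1`. -/
def IsTransient {Ω : Type*} [MeasurableSpace Ω] (μ : Measure Ω) (X : ℕ → Ω → ℕ) : Prop :=
  ∀ x m : ℕ, μ {ω | X m ω = x} ≠ 0 →
    ProbabilityTheory.cond μ {ω | X m ω = x} {ω | ∃ n, m < n ∧ X n ω = x} < 1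

/-- `U_i = (1 - E_i) / E_i` (used for `i ≥ 1`). -/
noncomputable def U (p : ℕ → ℝ) (i : ℕ) : ℝ := (1 - E p i) / E p i

/-- `D(m, n)`: it is `0` for `n = m`, `1` for `n = m + 1` (empty sum), and
`1 + ∑_{j=1}^{n-m-1} ∏_{i=1}^{j} U_{m+i}` for `n ≥ m + 2`. It is not used for `n < m`. -/
noncomputable def DFin (p : ℕ → ℝ) (m n : ℕ) : ℝ :=
  if n ≤ m then 0
  else 1 + ∑ j ∈ Finset.Icc 1 (n - m - 1), ∏ i ∈ Finset.Icc 1 j, U p (m + i)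

/-- `D(m) = lim_{n → ∞} D(m, n)`. -/
noncomputable def D (p : ℕ → ℝ) (m : ℕ) : ℝ := limUnder atTop (DFin p m)

/-- `R` is a cutpoint of the path `x`. -/
def IsCutpoint (x : ℕ → ℕ) (R : ℕ) : Prop :=
  ∃ k, (∀ i ≤ k, x i ≤ R) ∧ x k = R ∧ ∀ i, k < i → R < x i

/-- `R` is a strong cutpoint of the path `x`. -/
def IsStrongCutpoint (x : ℕ → ℕ) (R : ℕ) : Prop :=
  ∃ k, (∀ i < k, x i < R) ∧ x k = R ∧ ∀ i, k < i → R < x i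

/-- When `∑_k U_1 ⋯ U_k` converges, the limit defining `D(m)` exists. -/
theorem tendsto_DFin (p : ℕ → ℝ) (hp : ∀ i, 1 ≤ i → 0 ≤ p i ∧ p i < 1 / 2)
    (hs : Summable fun k : ℕ => ∏ i ∈ Finset.Icc 1 k, U p i) (m : ℕ) :
    Tendsto (DFin p m) atTop (𝓝 (D p m)) := by
  have hU : ∀ i, 1 ≤ i → 0 < U p i := by
    intro i hi
    obtain ⟨h0, h1⟩ := hp i hi
    have hi0 : i ≠ 0 := by omega
    simp only [U, E, hi0, if_false]
    apply div_pos <;> linarith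
  have hP : ∀ k, 0 < ∏ i ∈ Finset.Icc 1 k, U p i := fun k =>
    Finset.prod_pos fun i hi => hU i (Finset.mem_Icc.1 hi).1
  have hprod : ∀ j, ∏ i ∈ Finset.Icc 1 j, U p (m + i) =
      (∏ i ∈ Finset.Icc 1 m, U p i)⁻¹ * ∏ i ∈ Finset.Icc 1 (j + m), U p i := by
    intro j
    induction j with
    | zero => simp [(hP m).ne']
    | succ j ih =>
      rw [Finset.prod_Icc_succ_top (by omega), ih, show j + 1 + m = j + m + 1 by omega,
        Finset.prod_Icc_succ_top (by omega), show m + (j + 1) = j + m + 1 by omega, mul_assoc]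
  have hsum : Summable fun j : ℕ => ∏ i ∈ Finset.Icc 1 (j + 1), U p (m + i) := by
    have h1 : Summable fun j : ℕ => ∏ i ∈ Finset.Icc 1 j, U p (m + i) := by
      simp only [hprod]
      exact (hs.comp_injective (add_left_injective m)).mul_left _
    exact h1.comp_injective (add_left_injective 1)
  have hIcc : ∀ n, DFin p m (n + (m + 1)) =
      1 + ∑ j ∈ Finset.range n, ∏ i ∈ Finset.Icc 1 (j + 1), U p (m + i) := by
    intro n
    have hn : ¬ n + (m + 1) ≤ m := by omega
    have hn2 : n + (m + 1) - m - 1 = n := by omega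
    rw [DFin, if_neg hn, hn2]
    congr 1
    clear hn hn2
    induction n with
    | zero => simp
    | succ n ih => rw [Finset.sum_range_succ, Finset.sum_Icc_succ_top (by omega), ih]
  have ht : Tendsto (fun n => DFin p m (n + (m + 1))) atTop
      (𝓝 (1 + ∑' j : ℕ, ∏ i ∈ Finset.Icc 1 (j + 1), U p (m + i))) := by
    simp only [hIcc]
    exact hsum.hasSum.tendsto_sum_nat.const_add 1
  exact tendsto_nhds_limUnder ⟨_, (tendsto_add_atTop_iff_nat (m + 1)).1 ht⟩

end BirthDeath

/-! Let Y_s be the lowest site visited while the running maximum equals s. The walk is almost surely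
unbounded, so every level occurs; R is then a cutpoint iff Y_s > R for all s > R, and a strong one
iff moreover Y_R ≥ R. The Y_s are independent, with gambler's-ruin tails P(Y_s ≥ a) = D(a-1, s) /
D(a-1, s+1) for a ≥ 1; a bounded martingale yields this joint law (`measure_forall_le_levelMin`).
The products telescope: R is a cutpoint with probability 1/D(R) and a strong one with probability
E_R/D(R). For i < j, both are strong cutpoints with probability (E_i/D(i, j)) (E_j/D(j)).

(a) Given that j is the last cutpoint before b, a site i ≤ j is a cutpoint with probability 1/D(i,
j+1) ≥ 1/(j+1-i). One cutpoint in [a, b) thus forces about log(a-l) expected cutpoints in [l, b),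
while the mean number there is the sum of 1/D(i) (`log_mul_measureReal_le`). On dyadic blocks this
makes the probabilities of seeing a cutpoint summable, and Borel–Cantelli applies.

(b) Count strong cutpoints with weight 1/log R; the mean diverges. The correlation factor of a pair
is D(i)/D(i, j). It is bounded for j ≥ i^2 by the growth condition on D, and the pairs with j < i^2
cost O(log i), which the weight absorbs. The second moment is therefore comparable to the squared
mean, so infinitely many strong cutpoints occur with positive probability, hence almost surely by
Kolmogorov's 0-1 law. -/

namespace BirthDeath

open ProbabilityTheory
open scoped ENNReal

/-- The products `U_1 ⋯ U_n`, i.e. the increments of the scale function of the walk. -/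
noncomputable def scaleIncr (p : ℕ → ℝ) (n : ℕ) : ℝ := ∏ i ∈ Finset.Icc 1 n, U p i

/-- The drift is nonnegative and the walk can step down from every positive site. -/
def NonnegDrift (p : ℕ → ℝ) : Prop := ∀ i, 1 ≤ i → 0 ≤ p i ∧ p i < 1 / 2

/-! ### The scale function and D(m, n) -/

section Scale

variable {p : ℕ → ℝ}

theorem scaleIncr_zero (p : ℕ → ℝ) : scaleIncr p 0 = 1 := by simp [scaleIncr]

theorem scaleIncr_succ (p : ℕ → ℝ) (n : ℕ) :
    scaleIncr p (n + 1) = scaleIncr p n * U p (n + 1) := by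
  rw [scaleIncr, Finset.prod_Icc_succ_top (by omega), scaleIncr]

theorem NonnegDrift.half_le_E (hp : NonnegDrift p) (i : ℕ) : 1 / 2 ≤ E p i := by
  rcases Nat.eq_zero_or_pos i with rfl | hi
  · norm_num [E]
  · simp only [E, hi.ne', if_false]; linarith [(hp i hi).1]

theorem NonnegDrift.E_le_one (hp : NonnegDrift p) (i : ℕ) : E p i ≤ 1 := by
  rcases Nat.eq_zero_or_pos i with rfl | hi
  · norm_num [E]
  · simp only [E, hi.ne', if_false]; linarith [(hp i hi).2]

theorem NonnegDrift.E_pos (hp : NonnegDrift p) (i : ℕ) : 0 < E p i := by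
  linarith [hp.half_le_E i]

theorem NonnegDrift.U_pos (hp : NonnegDrift p) {i : ℕ} (hi : 1 ≤ i) : 0 < U p i := by
  have hi0 : i ≠ 0 := by omega
  obtain ⟨h0, h1⟩ := hp i hi
  simp only [U, E, hi0, if_false]
  apply div_pos <;> linarith

theorem NonnegDrift.U_le_one (hp : NonnegDrift p) (i : ℕ) : U p i ≤ 1 := by
  rw [U, div_le_one (hp.E_pos i)]
  linarith [hp.half_le_E i]

theorem NonnegDrift.scaleIncr_pos (hp : NonnegDrift p) (n : ℕ) : 0 < scaleIncr p n :=
  Finset.prod_pos fun _ hi => hp.U_pos (Finset.mem_Icc.1 hi).1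

theorem NonnegDrift.scaleIncr_antitone (hp : NonnegDrift p) : Antitone (scaleIncr p) :=
  antitone_nat_of_succ_le fun n => by
    rw [scaleIncr_succ]
    exact mul_le_of_le_one_right (hp.scaleIncr_pos n).le (hp.U_le_one _)

theorem prod_U_shift (p : ℕ → ℝ) (m j : ℕ) :
    scaleIncr p m * ∏ i ∈ Finset.Icc 1 j, U p (m + i) = scaleIncr p (m + j) := by
  induction j with
  | zero => simp
  | succ j ih =>
    rw [Finset.prod_Icc_succ_top (by omega), ← mul_assoc, ih, ← add_assoc, scaleIncr_succ]

theorem DFin_of_le (p : ℕ → ℝ) {m n : ℕ} (h : n ≤ m) : DFin p m n = 0 := by simp [DFin, h]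

/-- A normalised difference of the scale function, whose increments are positive and, the drift
being nonnegative, decreasing. Estimates on `DFin` come from this form. -/
theorem NonnegDrift.DFin_eq (hp : NonnegDrift p) (m n : ℕ) :
    DFin p m n = (∑ j ∈ Finset.Ico m n, scaleIncr p j) / scaleIncr p m := by
  rcases le_or_gt n m with h | h
  · simp [DFin_of_le p h, Finset.Ico_eq_empty_of_le h]
  rw [eq_div_iff (hp.scaleIncr_pos m).ne', DFin, if_neg (by omega)]
  obtain ⟨k, rfl⟩ : ∃ k, n = m + 1 + k := ⟨n - m - 1, by omega⟩
  rw [show m + 1 + k - m - 1 = k by omega]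
  clear h
  induction k with
  | zero => simp
  | succ k ih =>
    rw [Finset.sum_Icc_succ_top (by omega), ← add_assoc, add_mul, ih, ← add_assoc,
      Finset.sum_Ico_succ_top (by omega), mul_comm _ (scaleIncr p m), prod_U_shift]
    congr 2; omega

theorem NonnegDrift.DFin_nonneg (hp : NonnegDrift p) (m n : ℕ) : 0 ≤ DFin p m n := by
  rw [hp.DFin_eq]
  exact div_nonneg (Finset.sum_nonneg fun _ _ => (hp.scaleIncr_pos _).le) (hp.scaleIncr_pos m).le

theorem NonnegDrift.DFin_succ_right (hp : NonnegDrift p) {m n : ℕ} (h : m ≤ n) :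
    DFin p m (n + 1) = DFin p m n + scaleIncr p n / scaleIncr p m := by
  rw [hp.DFin_eq, hp.DFin_eq, Finset.sum_Ico_succ_top h, add_div]

theorem NonnegDrift.DFin_mono (hp : NonnegDrift p) (m : ℕ) : Monotone (DFin p m) :=
  monotone_nat_of_le_succ fun n => by
    rcases le_or_gt m n with h | h
    · rw [hp.DFin_succ_right h]
      linarith [div_pos (hp.scaleIncr_pos n) (hp.scaleIncr_pos m)]
    · rw [DFin_of_le p h.le, DFin_of_le p h]

theorem NonnegDrift.DFin_self_succ (hp : NonnegDrift p) (m : ℕ) : DFin p m (m + 1) = 1 := by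
  rw [hp.DFin_succ_right le_rfl, DFin_of_le p le_rfl, div_self (hp.scaleIncr_pos m).ne', zero_add]

theorem NonnegDrift.one_le_DFin (hp : NonnegDrift p) {m n : ℕ} (h : m < n) : 1 ≤ DFin p m n := by
  rw [← hp.DFin_self_succ m]; exact hp.DFin_mono m h

/-- Each normalised increment is at most 1. This is the source of the harmonic sum, hence of the
logarithm, in part (a). -/
theorem NonnegDrift.DFin_le_sub (hp : NonnegDrift p) {m n : ℕ} (h : m ≤ n) :
    DFin p m n ≤ (n : ℝ) - m := by
  induction n, h using Nat.le_induction with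
  | base => simp [DFin_of_le p le_rfl]
  | succ n hn ih =>
    rw [hp.DFin_succ_right hn]
    have : scaleIncr p n / scaleIncr p m ≤ 1 :=
      (div_le_one (hp.scaleIncr_pos m)).2 (hp.scaleIncr_antitone hn)
    push_cast; linarith

theorem NonnegDrift.DFin_pred_succ (hp : NonnegDrift p) (n : ℕ) :
    DFin p n (n + 2) = 1 / E p (n + 1) := by
  rw [hp.DFin_succ_right (by omega), hp.DFin_self_succ, scaleIncr_succ,
    mul_div_cancel_left₀ _ (hp.scaleIncr_pos n).ne', U]
  have := (hp.E_pos (n + 1)).ne'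
  field_simp
  ring

/-- Away from `m`, the function `DFin p m` is harmonic for the walk. -/
theorem NonnegDrift.DFin_harmonic (hp : NonnegDrift p) {m x : ℕ} (h : m < x) :
    E p x * DFin p m (x + 1) + (1 - E p x) * DFin p m (x - 1) = DFin p m x := by
  obtain ⟨y, rfl⟩ : ∃ y, x = y + 1 := ⟨x - 1, by omega⟩
  rw [hp.DFin_succ_right h.le, Nat.add_sub_cancel, hp.DFin_succ_right (Nat.lt_succ_iff.1 h),
    scaleIncr_succ, U]
  have := (hp.E_pos (y + 1)).ne'
  have := (hp.scaleIncr_pos m).ne'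
  field_simp
  ring

end Scale

/-! ### Gambler's ruin -/

/-- Probability that the walk at `x`, with running maximum `m`, reaches `m + 1` before going
below `a`. -/
noncomputable def upProb (p : ℕ → ℝ) (a m x : ℕ) : ℝ :=
  if a = 0 then 1 else DFin p (a - 1) x / DFin p (a - 1) (m + 1)

section UpProb

variable {p : ℕ → ℝ}

theorem NonnegDrift.upProb_nonneg (hp : NonnegDrift p) (a m x : ℕ) : 0 ≤ upProb p a m x := by
  unfold upProb
  split_ifs
  · exact zero_le_one
  · exact div_nonneg (hp.DFin_nonneg _ _) (hp.DFin_nonneg _ _)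

theorem NonnegDrift.upProb_le_one (hp : NonnegDrift p) (a : ℕ) {m x : ℕ} (h : x ≤ m + 1) :
    upProb p a m x ≤ 1 := by
  unfold upProb
  split_ifs
  · exact le_rfl
  · exact div_le_one_of_le₀ (hp.DFin_mono _ h) (hp.DFin_nonneg _ _)

theorem upProb_of_lt (p : ℕ → ℝ) {a x : ℕ} (m : ℕ) (h : x < a) : upProb p a m x = 0 := by
  rw [upProb, if_neg (by omega), DFin_of_le p (by omega), zero_div]

theorem NonnegDrift.upProb_succ (hp : NonnegDrift p) {a m : ℕ} (h : a ≤ m + 1) :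
    upProb p a m (m + 1) = 1 := by
  unfold upProb
  split_ifs with h0
  · rfl
  · exact div_self (by linarith [hp.one_le_DFin (show a - 1 < m + 1 by omega)])

theorem NonnegDrift.upProb_harmonic (hp : NonnegDrift p) {a x : ℕ} (m : ℕ) (h : a ≤ x) :
    E p x * upProb p a m (x + 1) + (1 - E p x) * upProb p a m (x - 1) = upProb p a m x := by
  unfold upProb
  split_ifs with h0
  · ring
  · rw [← mul_div_assoc, ← mul_div_assoc, ← add_div, hp.DFin_harmonic (by omega)]

theorem upProb_zero (p : ℕ → ℝ) (m x : ℕ) : upProb p 0 m x = 1 := by simp [upProb]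

/-- With the barrier just below m, the first step decides. -/
theorem NonnegDrift.upProb_self (hp : NonnegDrift p) (m : ℕ) : upProb p m m m = E p m := by
  cases m with
  | zero => simp [upProb, E]
  | succ m =>
    rw [upProb, if_neg (by omega), Nat.add_sub_cancel, hp.DFin_pred_succ, hp.DFin_self_succ]
    simp

/-- The probabilities of passing the successive levels above `r` without falling back to `r`
multiply to `1 / D(r, n)`. -/
theorem NonnegDrift.prod_upProb (hp : NonnegDrift p) {r n : ℕ} (h : r < n) :
    ∏ s ∈ Finset.Ioo r n, upProb p (r + 1) s s = 1 / DFin p r n := by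
  induction n, h using Nat.le_induction with
  | base =>
    have : Finset.Ioo r (r + 1) = ∅ := by ext; simp
    simp [this, hp.DFin_self_succ]
  | succ n hn ih =>
    have hn : r < n := hn
    have : Finset.Ioo r (n + 1) = insert n (Finset.Ioo r n) := by ext; simp; omega
    -- The new factor is `DFin p r n / DFin p r (n + 1)`, so the product telescopes.
    rw [this, Finset.prod_insert (by simp), ih, upProb, if_neg (by omega), Nat.add_sub_cancel]
    have := hp.one_le_DFin hn
    field_simp

end UpProb

/-- Splitting over countably many measurable fibres works for arbitrary g, so functionals of the
past can be used below without measurability checks. -/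
theorem lintegral_eq_tsum_fiber {Ω β : Type*} [MeasurableSpace Ω] [Countable β]
    [MeasurableSpace β] [MeasurableSingletonClass β] {μ : Measure Ω} {Z : Ω → β}
    (hZ : Measurable Z) (g : Ω → ℝ≥0∞) :
    ∫⁻ ω, g ω ∂μ = ∑' z, ∫⁻ ω in Z ⁻¹' {z}, g ω ∂μ := by
  have hu : ⋃ z, Z ⁻¹' {z} = Set.univ := by ext; simp
  rw [← lintegral_iUnion (fun z => hZ (measurableSet_singleton z)), hu, setLIntegral_univ]
  intro a b hab
  exact Disjoint.preimage _ (by simpa using hab)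

/-! ### Markov property and unboundedness -/

section Chain

variable {Ω : Type*} [MeasurableSpace Ω] {μ : Measure Ω} {p : ℕ → ℝ} {X : ℕ → Ω → ℕ}

theorem step_up (p : ℕ → ℝ) (x : ℕ) : step p x (x + 1) = E p x := by simp [step]

theorem step_down (p : ℕ → ℝ) (x : ℕ) : step p x (x - 1) = 1 - E p x := by
  cases x with
  | zero => simp [step, E]
  | succ x => rw [step, if_neg (by omega), if_pos (by omega)]

theorem step_of_ne (p : ℕ → ℝ) {x j : ℕ} (h1 : j ≠ x + 1) (h2 : j ≠ x - 1) : step p x j = 0 := by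
  rw [step, if_neg h1, if_neg (by omega)]

/-- The Markov property for functions of the past and the next state. -/
theorem IsMarkovChain.lintegral_next (hX : IsMarkovChain μ (step p) X) (n : ℕ)
    {F : Ω → ℕ → ℝ≥0∞} (hF : ∀ ω ω', (∀ i ≤ n, X i ω = X i ω') → F ω = F ω') :
    ∫⁻ ω, F ω (X (n + 1) ω) ∂μ =
      ∫⁻ ω, (ENNReal.ofReal (E p (X n ω)) * F ω (X n ω + 1) +
        ENNReal.ofReal (1 - E p (X n ω)) * F ω (X n ω - 1)) ∂μ := by
  let Z : Ω → (Fin (n + 1) → ℕ) := fun ω i => X i ω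
  have hZ : Measurable Z := measurable_pi_lambda _ fun i => hX.measurable i
  rw [lintegral_eq_tsum_fiber hZ, lintegral_eq_tsum_fiber hZ]
  refine tsum_congr fun z => ?_
  have hm : MeasurableSet (Z ⁻¹' {z}) := hZ (measurableSet_singleton z)
  rcases (Z ⁻¹' {z}).eq_empty_or_nonempty with he | ⟨ω₀, hω₀⟩
  · simp [he]
  have hset : Z ⁻¹' {z} = {ω | ∀ i ≤ n, X i ω = X i ω₀} := by
    ext ω
    have h0 : Z ω₀ = z := hω₀
    simp only [Set.mem_preimage, Set.mem_singleton_iff, ← h0, Set.mem_ofPred_eq, Z, funext_iff]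
    exact ⟨fun h i hi => h ⟨i, by omega⟩, fun h i => h i (by omega)⟩
  have hmem : ∀ ω ∈ Z ⁻¹' {z}, F ω = F ω₀ ∧ X n ω = X n ω₀ := by
    intro ω hω
    rw [hset] at hω
    exact ⟨hF _ _ hω, hω n le_rfl⟩
  rw [setLIntegral_congr_fun hm (f := fun ω => F ω (X (n + 1) ω))
      (g := fun ω => F ω₀ (X (n + 1) ω)) (fun ω hω => by simp only [(hmem ω hω).1]),
    setLIntegral_congr_fun hm (f := fun ω => ENNReal.ofReal (E p (X n ω)) * F ω (X n ω + 1) +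
        ENNReal.ofReal (1 - E p (X n ω)) * F ω (X n ω - 1)) (g := fun _ => ENNReal.ofReal (E p (X n ω₀)) * F ω₀ (X n ω₀ + 1) +
        ENNReal.ofReal (1 - E p (X n ω₀)) * F ω₀ (X n ω₀ - 1))
      (fun ω hω => by simp only [(hmem ω hω).1, (hmem ω hω).2]),
    setLIntegral_const, lintegral_eq_tsum_fiber (hX.measurable (n + 1))]
  have hj : ∀ j, ∫⁻ ω in X (n + 1) ⁻¹' {j}, F ω₀ (X (n + 1) ω) ∂(μ.restrict (Z ⁻¹' {z})) =
      F ω₀ j * (ENNReal.ofReal (step p (X n ω₀) j) * μ (Z ⁻¹' {z})) := by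
    intro j
    have hmj : MeasurableSet (X (n + 1) ⁻¹' {j}) := hX.measurable _ (measurableSet_singleton j)
    rw [setLIntegral_congr_fun hmj (g := fun _ => F ω₀ j)
      (fun ω hω => by simp only [show X (n + 1) ω = j from hω]), setLIntegral_const,
      Measure.restrict_apply hmj, hset, ← hX.markov n (fun i => X i ω₀) j]
    congr 2
    ext ω
    simp [and_comm]
  simp only [hj]
  -- At site 0 truncated subtraction makes the lower neighbour 0 itself; its weight 1 - E_0 is zero.
  rw [tsum_eq_sum (s := {X n ω₀ + 1, X n ω₀ - 1}), Finset.sum_pair (by omega), step_up, step_down]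
  · ring
  · intro j hj'
    simp only [Finset.mem_insert, Finset.mem_singleton, not_or] at hj'
    simp [step_of_ne p hj'.1 hj'.2]

theorem IsMarkovChain.ae_nearest_neighbour (hX : IsMarkovChain μ (step p) X) :
    ∀ᵐ ω ∂μ, ∀ n, X (n + 1) ω = X n ω + 1 ∨ X n ω = X (n + 1) ω + 1 := by
  rw [ae_all_iff]
  intro n
  let F : Ω → ℕ → ℝ≥0∞ := fun ω j => if j = X n ω + 1 ∨ X n ω = j + 1 then 0 else 1
  have h := hX.lintegral_next n (F := F)
    (fun ω ω' h => by simp only [F, h n le_rfl])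
  have h0 : ∫⁻ ω, F ω (X (n + 1) ω) ∂μ = 0 := by
    rw [h, lintegral_eq_zero_iff']
    · filter_upwards with ω
      rcases Nat.eq_zero_or_pos (X n ω) with h0 | h0
      · simp [F, h0, E]
      · have : X n ω = X n ω - 1 + 1 := by omega
        simp [F, ← this]
    · apply Measurable.aemeasurable
      have : (fun ω => ENNReal.ofReal (E p (X n ω)) * F ω (X n ω + 1) +
        ENNReal.ofReal (1 - E p (X n ω)) * F ω (X n ω - 1)) =
        (fun x : ℕ => ENNReal.ofReal (E p x) * (if x + 1 = x + 1 ∨ x = x + 1 + 1 then 0 else 1) +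
        ENNReal.ofReal (1 - E p x) * (if x - 1 = x + 1 ∨ x = x - 1 + 1 then 0 else 1)) ∘ X n := rfl
      rw [this]
      exact (measurable_of_countable _).comp (hX.measurable n)
  have hFm : Measurable fun ω => F ω (X (n + 1) ω) := by
    have : (fun ω => F ω (X (n + 1) ω)) =
      (fun x : ℕ × ℕ => if x.2 = x.1 + 1 ∨ x.1 = x.2 + 1 then (0 : ℝ≥0∞) else 1) ∘
        fun ω => (X n ω, X (n + 1) ω) := rfl
    rw [this]
    exact (measurable_of_countable _).comp ((hX.measurable n).prodMk (hX.measurable (n + 1)))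
  rw [lintegral_eq_zero_iff hFm] at h0
  filter_upwards [h0] with ω hω
  by_contra hne
  simp [F, hne] at hω

theorem partialSups_congr {x y : ℕ → ℕ} {n : ℕ} (h : ∀ i ≤ n, x i = y i) :
    partialSups x n = partialSups y n := by
  apply le_antisymm
  · exact partialSups_le _ _ _ fun i hi => (h i hi).trans_le (le_partialSups_of_le y hi)
  · exact partialSups_le _ _ _ fun i hi => (h i hi).symm.trans_le (le_partialSups_of_le x hi)

theorem partialSups_nat_succ (x : ℕ → ℕ) (n : ℕ) :
    partialSups x (n + 1) = max (partialSups x n) (x (n + 1)) := by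
  simp

theorem measurable_partialSups_nat (hX : ∀ n, Measurable (X n)) (n : ℕ) :
    Measurable fun ω => partialSups (fun k => X k ω) n := by
  induction n with
  | zero => simp [hX 0]
  | succ n ih => simpa only [partialSups_nat_succ] using ih.max (hX (n + 1))

/-- The walk is almost surely unbounded: `X²`, stopped when exceeding a level `N`, gains at
least one unit of mean per step. -/
theorem IsMarkovChain.ae_unbounded [IsProbabilityMeasure μ] (hp : NonnegDrift p)
    (hX : IsMarkovChain μ (step p) X) :
    ∀ᵐ ω ∂μ, ∀ N, ∃ n, N < partialSups (fun k => X k ω) n := by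
  rw [ae_all_iff]
  intro N
  let M : ℕ → Ω → ℕ := fun n ω => partialSups (fun k => X k ω) n
  -- The truncation at N + 1 is inactive while the maximum is at most N; it makes the uniform bound
  -- (N + 1)^2 immediate.
  let S : ℕ → Ω → ℝ≥0∞ := fun n ω =>
    if M n ω ≤ N then (((min (X n ω) (N + 1)) ^ 2 : ℕ) : ℝ≥0∞) else (((N + 1) ^ 2 : ℕ) : ℝ≥0∞)
  let B : Set Ω := {ω | ∀ n, M n ω ≤ N}
  have hMm : ∀ n, Measurable (M n) := fun n => measurable_partialSups_nat hX.measurable n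
  have hBm : MeasurableSet B := by
    simp only [B, Set.ofPred_forall]
    exact MeasurableSet.iInter fun n => hMm n measurableSet_Iic
  have hS : ∀ n, S n = (fun x : ℕ × ℕ => if x.1 ≤ N then (((min x.2 (N + 1)) ^ 2 : ℕ) : ℝ≥0∞)
      else (((N + 1) ^ 2 : ℕ) : ℝ≥0∞)) ∘ fun ω => (M n ω, X n ω) := fun n => rfl
  have hSm : ∀ n, Measurable (S n) := fun n => by
    rw [hS]
    exact (measurable_of_countable _).comp ((hMm n).prodMk (hX.measurable n))
  have hbound : ∀ n, ∫⁻ ω, S n ω ∂μ ≤ (((N + 1) ^ 2 : ℕ) : ℝ≥0∞) := by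
    intro n
    calc ∫⁻ ω, S n ω ∂μ ≤ ∫⁻ _, (((N + 1) ^ 2 : ℕ) : ℝ≥0∞) ∂μ := by
          refine lintegral_mono fun ω => ?_
          simp only [S]
          split_ifs
          · exact Nat.cast_le.2 (Nat.pow_le_pow_left (min_le_right _ _) 2)
          · exact le_rfl
      _ = _ := by simp
  have hstep : ∀ n, ∫⁻ ω, S n ω ∂μ + μ B ≤ ∫⁻ ω, S (n + 1) ω ∂μ := by
    intro n
    have h1 : ∀ ω, S (n + 1) ω = (fun j => if max (M n ω) j ≤ N then
        (((min j (N + 1)) ^ 2 : ℕ) : ℝ≥0∞) else (((N + 1) ^ 2 : ℕ) : ℝ≥0∞)) (X (n + 1) ω) := by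
      intro ω
      simp only [S, M, partialSups_nat_succ]
    rw [lintegral_congr h1, hX.lintegral_next n (F := fun ω j => if max (M n ω) j ≤ N then
        (((min j (N + 1)) ^ 2 : ℕ) : ℝ≥0∞) else (((N + 1) ^ 2 : ℕ) : ℝ≥0∞))
      (fun ω ω' h => by simp only [M, partialSups_congr h]),
      ← lintegral_indicator_one hBm, ← lintegral_add_left (hSm n)]
    refine lintegral_mono fun ω => ?_
    have hE1 := hp.E_le_one (X n ω)
    have hE2 := hp.half_le_E (X n ω)
    by_cases hM : M n ω ≤ N
    · have hx : X n ω ≤ N := (le_partialSups_of_le (fun k => X k ω) le_rfl).trans hM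
      have e1 : (if max (M n ω) (X n ω + 1) ≤ N then
          (((min (X n ω + 1) (N + 1)) ^ 2 : ℕ) : ℝ≥0∞) else (((N + 1) ^ 2 : ℕ) : ℝ≥0∞)) =
          ENNReal.ofReal (((X n ω : ℝ) + 1) ^ 2) := by
        have : (((X n ω : ℝ) + 1) ^ 2) = (((X n ω + 1) ^ 2 : ℕ) : ℝ) := by push_cast; ring
        rw [this, ENNReal.ofReal_natCast]
        split_ifs with h
        · rw [min_eq_left (by omega)]
        · rw [show X n ω = N by omega]
      have e2 : (if max (M n ω) (X n ω - 1) ≤ N then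
          (((min (X n ω - 1) (N + 1)) ^ 2 : ℕ) : ℝ≥0∞) else (((N + 1) ^ 2 : ℕ) : ℝ≥0∞)) =
          ENNReal.ofReal (((X n ω - 1 : ℕ) : ℝ) ^ 2) := by
        rw [if_pos (by omega), min_eq_left (by omega), ← Nat.cast_pow, ENNReal.ofReal_natCast]
      have e3 : S n ω = ENNReal.ofReal ((X n ω : ℝ) ^ 2) := by
        simp only [S]
        rw [if_pos hM, min_eq_left (by omega), ← Nat.cast_pow, ENNReal.ofReal_natCast]
      have e4 : B.indicator (1 : Ω → ℝ≥0∞) ω ≤ ENNReal.ofReal 1 := by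
        rw [ENNReal.ofReal_one]
        exact Set.indicator_le_self' (fun _ _ => zero_le) ω
      simp only [e1, e2, e3]
      refine (add_le_add_right e4 _).trans ?_
      rw [← ENNReal.ofReal_add (by positivity) zero_le_one,
        ← ENNReal.ofReal_mul (by linarith), ← ENNReal.ofReal_mul (by linarith),
        ← ENNReal.ofReal_add (by nlinarith [sq_nonneg ((X n ω : ℝ) + 1)])
          (mul_nonneg (by linarith) (by positivity))]
      apply ENNReal.ofReal_le_ofReal
      rcases Nat.eq_zero_or_pos (X n ω) with h0 | h0
      · rw [h0]; norm_num [E]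
      · rw [Nat.cast_sub h0]
        have : (1 : ℝ) ≤ X n ω := by exact_mod_cast h0
        push_cast
        nlinarith
    · have hB : ω ∉ B := fun h => hM (h n)
      have : ∀ j, ¬ max (M n ω) j ≤ N := fun j h => hM ((le_max_left _ _).trans h)
      simp only [S, if_neg hM, if_neg (this _), Set.indicator_of_notMem hB, add_zero, ← add_mul]
      rw [← ENNReal.ofReal_add (by linarith) (by linarith)]
      simp
  have hmul : ∀ n : ℕ, (n : ℝ≥0∞) * μ B ≤ ∫⁻ ω, S n ω ∂μ := by
    intro n
    induction n with
    | zero => simp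
    | succ n ih =>
      push_cast
      rw [add_mul, one_mul]
      exact (add_le_add_left ih _).trans (hstep n)
  have hB0 : μ B = 0 := by
    by_contra hne
    obtain ⟨n, hn⟩ := ENNReal.exists_nat_mul_gt hne (ENNReal.natCast_ne_top ((N + 1) ^ 2))
    exact absurd ((hmul n).trans (hbound n)) (not_le.2 hn)
  rw [ae_iff]
  simpa only [not_exists, not_lt] using hB0

end Chain

/-! ### Cutpoints of a deterministic path via level minima -/

/-- An unbounded nearest-neighbour path on `ℕ` started at `0`. -/
structure IsUnboundedPath (x : ℕ → ℕ) : Prop where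
  start : x 0 = 0
  nearest : ∀ n, x (n + 1) = x n + 1 ∨ x n = x (n + 1) + 1
  unbounded : ∀ N, ∃ n, N < partialSups x n

/-- The lowest site visited while the running maximum equals `s`. -/
noncomputable def levelMin (x : ℕ → ℕ) (s : ℕ) : ℕ := sInf {y | ∃ i, partialSups x i = s ∧ x i = y}

namespace IsUnboundedPath

variable {x : ℕ → ℕ}

/-- The first passage over a level `R` happens by a step from `R` to `R + 1`. -/
theorem exists_passage (hx : IsUnboundedPath x) (R : ℕ) :
    ∃ k, partialSups x k = R ∧ x k = R ∧ x (k + 1) = R + 1 ∧ partialSups x (k + 1) = R + 1 := by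
  classical
  have hex := hx.unbounded R
  obtain ⟨k, hk⟩ : ∃ k, Nat.find hex = k + 1 := by
    refine Nat.exists_eq_succ_of_ne_zero fun h0 => ?_
    have := Nat.find_spec hex
    rw [h0] at this
    simp [hx.start] at this
  have h1 : partialSups x k ≤ R := not_lt.1 (Nat.find_min hex (by omega))
  have h2 : R < partialSups x (k + 1) := hk ▸ Nat.find_spec hex
  have h3 := partialSups_nat_succ x k
  have h4 : x k ≤ partialSups x k := le_partialSups x k
  have h5 := hx.nearest k
  exact ⟨k, by omega, by omega, by omega, by omega⟩

theorem exists_partialSups_eq (hx : IsUnboundedPath x) (R : ℕ) : ∃ k, partialSups x k = R :=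
  (hx.exists_passage R).imp fun _ h => h.1

theorem le_levelMin_iff (hx : IsUnboundedPath x) {r s : ℕ} :
    r ≤ levelMin x s ↔ ∀ i, partialSups x i = s → r ≤ x i := by
  have hne : {y | ∃ i, partialSups x i = s ∧ x i = y}.Nonempty := by
    obtain ⟨k, hk⟩ := hx.exists_partialSups_eq s
    exact ⟨x k, k, hk, rfl⟩
  rw [levelMin, le_csInf_iff (OrderBot.bddBelow _) hne]
  simp

/-- Turns a condition on levels into one on times, which can be followed step by step along the
chain. -/
theorem forall_le_levelMin_iff (hx : IsUnboundedPath x) (a : ℕ → ℕ) (N : ℕ) :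
    (∀ s ≤ N, a s ≤ levelMin x s) ↔
      ∀ i, partialSups x i ≤ N → a (partialSups x i) ≤ x i := by
  simp only [hx.le_levelMin_iff]
  exact ⟨fun h i hi => h _ hi i rfl, fun h s hs i hi => hi ▸ h i (hi ▸ hs)⟩

/-- Times with running maximum above R all come after the last visit to a cutpoint R. Conversely,
the time of the first passage from R to R + 1 is a witness. -/
theorem isCutpoint_iff (hx : IsUnboundedPath x) {R : ℕ} :
    IsCutpoint x R ↔ ∀ s, R < s → R < levelMin x s := by
  constructor
  · rintro ⟨k, h1, -, h3⟩ s hs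
    refine hx.le_levelMin_iff.2 fun i hi => h3 i ?_
    by_contra! hik
    have : partialSups x i ≤ R := partialSups_le _ _ _ fun j hj => h1 j (hj.trans hik)
    omega
  · intro h
    obtain ⟨k, h1, h2, h3, h4⟩ := hx.exists_passage R
    refine ⟨k, fun i hi => (le_partialSups_of_le x hi).trans h1.le, h2, fun i hi => ?_⟩
    have : R + 1 ≤ partialSups x i := h4 ▸ (partialSups x).mono hi
    exact hx.le_levelMin_iff.1 (h _ this) i rfl

/-- If the path never goes below R while its maximum is R, it sits at R during that whole period; as
it moves at every step, the period is a single instant. -/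
theorem isStrongCutpoint_iff (hx : IsUnboundedPath x) {R : ℕ} :
    IsStrongCutpoint x R ↔ R ≤ levelMin x R ∧ ∀ s, R < s → R < levelMin x s := by
  constructor
  · rintro ⟨k, h1, h2, h3⟩
    refine ⟨hx.le_levelMin_iff.2 fun i hi => ?_, hx.isCutpoint_iff.1 ⟨k, fun i hi => ?_, h2, h3⟩⟩
    · rcases lt_trichotomy i k with hik | rfl | hik
      · have : partialSups x i ≤ R - 1 := partialSups_le _ _ _ fun j hj =>
          Nat.le_sub_one_of_lt (h1 j (by omega))
        have := h1 i hik
        omega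
      · exact h2.ge
      · exact (h3 i hik).le
    · rcases hi.lt_or_eq with hi | rfl
      · exact (h1 i hi).le
      · exact h2.le
  · rintro ⟨h1, h2⟩
    obtain ⟨k, hk1, hk2, hk3, hk4⟩ := hx.exists_passage R
    have hlast : ∀ i, k < i → R < x i := fun i hi =>
      hx.le_levelMin_iff.1 (h2 _ (hk4 ▸ (partialSups x).mono hi : R + 1 ≤ partialSups x i)) i rfl
    refine ⟨k, fun i hi => ?_, hk2, hlast⟩
    by_contra! hge
    have hconst : ∀ j, i ≤ j → j ≤ k → partialSups x j = R := fun j hij hjk => le_antisymm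
      (hk1 ▸ (partialSups x).mono hjk) (hge.trans (le_partialSups_of_le x hij))
    have hxc : ∀ j, i ≤ j → j ≤ k → x j = R := fun j hij hjk => le_antisymm
      (hconst j hij hjk ▸ le_partialSups x j) (hx.le_levelMin_iff.1 h1 j (hconst j hij hjk))
    have := hxc i le_rfl hi.le
    have := hxc (i + 1) (by omega) hi
    have := hx.nearest i
    omega

end IsUnboundedPath

/-! ### Joint law of the level minima -/

section Law

variable {Ω : Type*} [MeasurableSpace Ω] {μ : Measure Ω} {p : ℕ → ℝ} {X : ℕ → Ω → ℕ}

theorem IsMarkovChain.ae_isUnboundedPath [IsProbabilityMeasure μ] (hp : NonnegDrift p)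
    (hX : IsMarkovChain μ (step p) X) : ∀ᵐ ω ∂μ, IsUnboundedPath fun k => X k ω := by
  filter_upwards [hX.start, hX.ae_nearest_neighbour, hX.ae_unbounded hp] with ω h1 h2 h3
  exact ⟨h1, h2, h3⟩

theorem measurable_levelMin (hX : ∀ n, Measurable (X n)) (s : ℕ) :
    Measurable fun ω => levelMin (fun k => X k ω) s := by
  refine measurable_of_Ici fun r => ?_
  -- `sInf ∅ = 0`, so for r ≥ 1 the event also requires that level s be attained.
  rcases Nat.eq_zero_or_pos r with rfl | hr
  · simp
  have : (fun ω => levelMin (fun k => X k ω) s) ⁻¹' Set.Ici r =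
      (⋃ i, {ω | partialSups (fun k => X k ω) i = s}) ∩
        ⋂ i, ({ω | partialSups (fun k => X k ω) i = s}ᶜ ∪ {ω | r ≤ X i ω}) := by
    ext ω
    simp only [Set.mem_preimage, Set.mem_Ici, Set.mem_inter_iff, Set.mem_iUnion, Set.mem_iInter,
      Set.mem_union, Set.mem_compl_iff, Set.mem_ofPred_eq, levelMin, ← imp_iff_not_or]
    constructor
    · intro h
      have hne : {y | ∃ i, partialSups (fun k => X k ω) i = s ∧ X i ω = y}.Nonempty :=
        Nat.nonempty_of_pos_sInf (hr.trans_le h)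
      obtain ⟨y, i, hi, -⟩ := id hne
      exact ⟨⟨i, hi⟩, fun j hj => h.trans (Nat.sInf_le ⟨j, hj, rfl⟩)⟩
    · rintro ⟨⟨i, hi⟩, h⟩
      refine le_csInf ⟨X i ω, i, hi, rfl⟩ ?_
      rintro y ⟨j, hj, rfl⟩
      exact h j hj
  rw [this]
  have hM := fun i => measurable_partialSups_nat hX i
  exact (MeasurableSet.iUnion fun i => hM i (measurableSet_singleton s)).inter
    (MeasurableSet.iInter fun i => ((hM i (measurableSet_singleton s)).compl).union
      (hX i measurableSet_Ici))

/-- Conditional probability, given the running maximum `m` and the position `x`, that the walk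
stays above `a s` during the rest of its stay at every running maximum `s ∈ [m, N]`. -/
noncomputable def stayProb (p : ℕ → ℝ) (a : ℕ → ℕ) (N m x : ℕ) : ℝ :=
  if m ≤ N then upProb p (a m) m x * ∏ s ∈ Finset.Ioc m N, upProb p (a s) s s else 1

theorem stayProb_of_lt (p : ℕ → ℝ) (a : ℕ → ℕ) {N m : ℕ} (h : N < m) (x : ℕ) :
    stayProb p a N m x = 1 := if_neg (by omega)

theorem NonnegDrift.stayProb_nonneg (hp : NonnegDrift p) (a : ℕ → ℕ) (N m x : ℕ) :
    0 ≤ stayProb p a N m x := by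
  unfold stayProb
  split_ifs
  · exact mul_nonneg (hp.upProb_nonneg _ _ _) (Finset.prod_nonneg fun _ _ => hp.upProb_nonneg _ _ _)
  · exact zero_le_one

theorem NonnegDrift.stayProb_le_one (hp : NonnegDrift p) (a : ℕ → ℕ) (N : ℕ) {m x : ℕ}
    (h : x ≤ m) : stayProb p a N m x ≤ 1 := by
  unfold stayProb
  split_ifs
  · exact mul_le_one₀ (hp.upProb_le_one _ (by omega))
      (Finset.prod_nonneg fun _ _ => hp.upProb_nonneg _ _ _)
      (Finset.prod_le_one (fun _ _ => hp.upProb_nonneg _ _ _)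
        fun _ _ => hp.upProb_le_one _ (by omega))
  · exact le_rfl

theorem stayProb_self_succ (p : ℕ → ℝ) (a : ℕ → ℕ) {N m : ℕ} (h : m ≤ N) :
    stayProb p a N (m + 1) (m + 1) = ∏ s ∈ Finset.Ioc m N, upProb p (a s) s s := by
  unfold stayProb
  split_ifs with h'
  · have : Finset.Ioc m N = insert (m + 1) (Finset.Ioc (m + 1) N) := by
      ext; simp only [Finset.mem_Ioc, Finset.mem_insert]; omega
    rw [this, Finset.prod_insert (by simp)]
  · rw [Finset.Ioc_eq_empty (by omega), Finset.prod_empty]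

/-- Within a level this is harmonicity of `upProb`. At a new maximum the current factor reaches 1
and the remaining product is the value for the next level. -/
theorem NonnegDrift.stayProb_harmonic (hp : NonnegDrift p) (a : ℕ → ℕ) {N m x : ℕ} (hx : x ≤ m)
    (ha : m ≤ N → a m ≤ x) :
    E p x * stayProb p a N (max m (x + 1)) (x + 1) +
      (1 - E p x) * stayProb p a N (max m (x - 1)) (x - 1) = stayProb p a N m x := by
  rw [max_eq_left (show x - 1 ≤ m by omega)]
  by_cases hm : m ≤ N
  · have hup : stayProb p a N (max m (x + 1)) (x + 1) =
        upProb p (a m) m (x + 1) * ∏ s ∈ Finset.Ioc m N, upProb p (a s) s s := by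
      rcases hx.lt_or_eq with h | rfl
      · rw [max_eq_left h, stayProb, if_pos hm]
      · rw [max_eq_right (by omega), stayProb_self_succ p a hm,
          hp.upProb_succ ((ha hm).trans (by omega)), one_mul]
    rw [hup, stayProb, stayProb, if_pos hm, if_pos hm, ← hp.upProb_harmonic m (ha hm)]
    ring
  · rw [stayProb_of_lt p a (by omega), stayProb_of_lt p a (by omega), stayProb_of_lt p a (by omega)]
    ring

open Classical in
/-- The joint law of the minima at the successive running maxima. -/
theorem IsMarkovChain.measure_forall_le_levelMin [IsProbabilityMeasure μ] (hp : NonnegDrift p)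
    (hX : IsMarkovChain μ (step p) X) (a : ℕ → ℕ) (N : ℕ) :
    μ {ω | ∀ s ≤ N, a s ≤ levelMin (fun k => X k ω) s} =
      ENNReal.ofReal (∏ s ∈ Finset.range (N + 1), upProb p (a s) s s) := by
  let M : ℕ → Ω → ℕ := fun n ω => partialSups (fun k => X k ω) n
  -- Time n itself is excluded: a violation there is already recorded by `stayProb`, which vanishes
  -- below the barrier. Hence the mean of Φ is conserved also when the path fails at time n.
  let alive : ℕ → Ω → Prop := fun n ω => ∀ i < n, M i ω ≤ N → a (M i ω) ≤ X i ω
  let Φ : ℕ → Ω → ℝ≥0∞ := fun n ω =>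
    if alive n ω then ENNReal.ofReal (stayProb p a N (M n ω) (X n ω)) else 0
  have hMm : ∀ n, Measurable (M n) := fun n => measurable_partialSups_nat hX.measurable n
  have halive : ∀ n, MeasurableSet {ω | alive n ω} := by
    intro n
    have : {ω | alive n ω} = ⋂ i, ⋂ (_ : i < n),
        (fun ω => (M i ω, X i ω)) ⁻¹' {y | y.1 ≤ N → a y.1 ≤ y.2} := by
      ext; simp [alive]
    rw [this]
    exact MeasurableSet.iInter fun i => MeasurableSet.iInter fun _ =>
      ((hMm i).prodMk (hX.measurable i)) (Set.to_countable _).measurableSet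
  have hΦm : ∀ n, Measurable (Φ n) := fun n =>
    Measurable.ite (halive n)
      ((measurable_of_countable fun y : ℕ × ℕ => ENNReal.ofReal (stayProb p a N y.1 y.2)).comp
        ((hMm n).prodMk (hX.measurable n))) measurable_const
  have hstep : ∀ n, ∫⁻ ω, Φ (n + 1) ω ∂μ = ∫⁻ ω, Φ n ω ∂μ := by
    intro n
    have h1 : ∀ ω, Φ (n + 1) ω = (fun j => if alive (n + 1) ω then
        ENNReal.ofReal (stayProb p a N (max (M n ω) j) j) else 0) (X (n + 1) ω) := by
      intro ω
      simp only [Φ, M, partialSups_nat_succ]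
    rw [lintegral_congr h1, hX.lintegral_next n (F := fun ω j => if alive (n + 1) ω then
        ENNReal.ofReal (stayProb p a N (max (M n ω) j) j) else 0)]
    · refine lintegral_congr fun ω => ?_
      have hxm : X n ω ≤ M n ω := le_partialSups (fun k => X k ω) n
      by_cases hn1 : alive (n + 1) ω
      · have hn : alive n ω := fun i hi => hn1 i (by omega)
        simp only [Φ, if_pos hn1, if_pos hn]
        rw [← hp.stayProb_harmonic a hxm (hn1 n (by omega)),
          ENNReal.ofReal_add (mul_nonneg (hp.E_pos _).le (hp.stayProb_nonneg _ _ _ _))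
            (mul_nonneg (by linarith [hp.E_le_one (X n ω)]) (hp.stayProb_nonneg _ _ _ _)),
          ENNReal.ofReal_mul (hp.E_pos _).le,
          ENNReal.ofReal_mul (by linarith [hp.E_le_one (X n ω)])]
      · simp only [Φ, if_neg hn1, mul_zero, add_zero]
        symm
        by_cases hn : alive n ω
        · rw [if_pos hn]
          have : M n ω ≤ N ∧ X n ω < a (M n ω) := by
            by_contra hcon
            refine hn1 fun i hi hM => ?_
            rcases Nat.lt_succ_iff_lt_or_eq.1 hi with h | rfl
            · exact hn i h hM
            · by_contra hlt
              exact hcon ⟨hM, not_le.1 hlt⟩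
          rw [stayProb, if_pos this.1, upProb_of_lt p _ this.2, zero_mul, ENNReal.ofReal_zero]
        · rw [if_neg hn]
    · intro ω ω' h
      have hM : ∀ i ≤ n, M i ω = M i ω' := fun i hi =>
        partialSups_congr fun j hj => h j (hj.trans hi)
      have hal : alive (n + 1) ω ↔ alive (n + 1) ω' :=
        forall_congr' fun i => forall_congr' fun hi => by
          rw [hM i (by omega), h i (by omega)]
      simp only [hal, hM n le_rfl]
  have hconst : ∀ n, ∫⁻ ω, Φ n ω ∂μ =
      ENNReal.ofReal (∏ s ∈ Finset.range (N + 1), upProb p (a s) s s) := by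
    intro n
    induction n with
    | succ n ih => rw [hstep, ih]
    | zero =>
      rw [lintegral_congr_ae (g := fun _ =>
        ENNReal.ofReal (∏ s ∈ Finset.range (N + 1), upProb p (a s) s s))]
      · simp
      · filter_upwards [hX.start] with ω hω
        have hr : Finset.range (N + 1) = insert 0 (Finset.Ioc 0 N) := by
          ext; simp only [Finset.mem_range, Finset.mem_insert, Finset.mem_Ioc]; omega
        rw [hr, Finset.prod_insert (by simp)]
        simp [Φ, alive, M, hω, stayProb]
  -- Once the maximum exceeds N, `stayProb` is 1 and Φ is the indicator of the event.
  have hlim : Tendsto (fun n => ∫⁻ ω, Φ n ω ∂μ) atTop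
      (𝓝 (∫⁻ ω, {ω | ∀ s ≤ N, a s ≤ levelMin (fun k => X k ω) s}.indicator 1 ω ∂μ)) := by
    refine tendsto_lintegral_of_dominated_convergence (fun _ => 1) hΦm (fun n => ?_) (by simp) ?_
    · filter_upwards with ω
      simp only [Φ]
      split_ifs
      · exact ENNReal.ofReal_le_one.2 (hp.stayProb_le_one a N (le_partialSups (fun k => X k ω) n))
      · exact zero_le_one
    · filter_upwards [hX.ae_isUnboundedPath hp] with ω hω
      obtain ⟨n₀, hn₀⟩ := hω.unbounded N
      refine tendsto_const_nhds.congr' ?_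
      filter_upwards [eventually_ge_atTop n₀] with n hn
      have hM : ∀ i, n₀ ≤ i → N < M i ω := fun i hi =>
        hn₀.trans_le ((partialSups fun k => X k ω).mono hi)
      have hiff : alive n ω ↔ ∀ s ≤ N, a s ≤ levelMin (fun k => X k ω) s := by
        rw [hω.forall_le_levelMin_iff]
        refine ⟨fun h i hi => h i ?_ hi, fun h i _ => h i⟩
        by_contra! hni
        exact absurd hi (not_le.2 (hM i (hn.trans hni)))
      simp only [Φ, hiff, stayProb_of_lt p a (hM n hn), ENNReal.ofReal_one, Set.indicator_apply,
        Set.mem_ofPred_eq, Pi.one_apply]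
  have hmeas : MeasurableSet {ω | ∀ s ≤ N, a s ≤ levelMin (fun k => X k ω) s} := by
    simp only [Set.ofPred_forall]
    exact MeasurableSet.iInter fun s => MeasurableSet.iInter fun _ =>
      measurable_levelMin hX.measurable s measurableSet_Ici
  rw [← lintegral_indicator_one hmeas]
  simp only [hconst] at hlim
  exact tendsto_nhds_unique hlim tendsto_const_nhds

end Law

/-! ### Independence and cutpoint probabilities -/

/-- `Y` has the law of the successive minima `levelMin` of the walk. -/
structure HasLevelMinLaw {Ω : Type*} [MeasurableSpace Ω] (p : ℕ → ℝ) (μ : Measure Ω)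
    (Y : ℕ → Ω → ℕ) : Prop where
  measurable : ∀ s, Measurable (Y s)
  law : ∀ (a : ℕ → ℕ) (N : ℕ), μ {ω | ∀ s ≤ N, a s ≤ Y s ω} =
    ENNReal.ofReal (∏ s ∈ Finset.range (N + 1), upProb p (a s) s s)

/-- The event, in terms of level minima, that `R` is a cutpoint. -/
def cutEvent {Ω : Type*} (Y : ℕ → Ω → ℕ) (R : ℕ) : Set Ω := {ω | ∀ s, R < s → R < Y s ω}

/-- The event, in terms of level minima, that `R` is a strong cutpoint. -/
def strongCutEvent {Ω : Type*} (Y : ℕ → Ω → ℕ) (R : ℕ) : Set Ω :=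
  {ω | R ≤ Y R ω ∧ ∀ s, R < s → R < Y s ω}

/-- The `σ`-algebra generated by `Y s`, `s ∈ S`. -/
@[reducible] def sigmaOn {Ω : Type*} (Y : ℕ → Ω → ℕ) (S : Set ℕ) : MeasurableSpace Ω :=
  ⨆ s ∈ S, MeasurableSpace.comap (Y s) inferInstance

section SigmaOn

variable {Ω : Type*} {Y : ℕ → Ω → ℕ}

theorem measurableSet_sigmaOn_le {S : Set ℕ} {s : ℕ} (hs : s ∈ S) (r : ℕ) :
    MeasurableSet[sigmaOn Y S] {ω | r ≤ Y s ω} :=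
  le_iSup₂ (f := fun s (_ : s ∈ S) => MeasurableSpace.comap (Y s) inferInstance) s hs _
    ⟨Set.Ici r, measurableSet_Ici, rfl⟩

theorem measurableSet_cutEvent_sigmaOn {n R : ℕ} (h : n ≤ R + 1) :
    MeasurableSet[sigmaOn Y (Set.Ici n)] (cutEvent Y R) := by
  simp only [cutEvent, Set.ofPred_forall]
  exact MeasurableSet.iInter fun s => MeasurableSet.iInter fun hs =>
    measurableSet_sigmaOn_le (h.trans hs) (R + 1)

theorem measurableSet_strongCutEvent_sigmaOn {n R : ℕ} (h : n ≤ R) :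
    MeasurableSet[sigmaOn Y (Set.Ici n)] (strongCutEvent Y R) :=
  (measurableSet_sigmaOn_le h R).inter (measurableSet_cutEvent_sigmaOn (by omega))

theorem sigmaOn_le [m : MeasurableSpace Ω] (hY : ∀ s, Measurable (Y s)) (S : Set ℕ) :
    sigmaOn Y S ≤ m :=
  iSup₂_le fun s _ => (hY s).comap_le

/-- For R ≥ n the event at R involves only levels s ≥ n, and discarding finitely many R does not
affect infinitude; so this is a tail event. -/
theorem measurableSet_limsup_strongCutEvent_infinite :
    MeasurableSet[limsup (fun s => MeasurableSpace.comap (Y s) inferInstance) atTop]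
      {ω | {R | ω ∈ strongCutEvent Y R}.Infinite} := by
  rw [limsup_eq_iInf_iSup_of_nat, MeasurableSpace.measurableSet_iInf]
  intro n
  have : {ω | {R | ω ∈ strongCutEvent Y R}.Infinite} =
      ⋂ M, ⋃ R, ⋃ (_ : max M n ≤ R), strongCutEvent Y R := by
    ext ω
    have h1 : ω ∈ {ω | {R | ω ∈ strongCutEvent Y R}.Infinite} ↔
        ∃ᶠ R in atTop, ω ∈ strongCutEvent Y R := Nat.frequently_atTop_iff_infinite.symm
    rw [h1, frequently_atTop]
    simp only [Set.mem_iInter, Set.mem_iUnion, exists_prop]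
    exact ⟨fun h M => h (max M n), fun h M => (h M).imp fun R hR => ⟨le_of_max_le_left hR.1, hR.2⟩⟩
  rw [this]
  exact MeasurableSet.iInter fun M => MeasurableSet.iUnion fun R => MeasurableSet.iUnion fun hR =>
    measurableSet_strongCutEvent_sigmaOn (le_of_max_le_right hR)

end SigmaOn

namespace HasLevelMinLaw

variable {Ω : Type*} [MeasurableSpace Ω] {μ : Measure Ω} {p : ℕ → ℝ} {Y : ℕ → Ω → ℕ}

theorem measurableSet_le (hY : HasLevelMinLaw p μ Y) (r s : ℕ) :
    MeasurableSet {ω | r ≤ Y s ω} := hY.measurable s measurableSet_Ici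

theorem measurableSet_cutEvent (hY : HasLevelMinLaw p μ Y) (R : ℕ) :
    MeasurableSet (cutEvent Y R) :=
  sigmaOn_le hY.measurable _ _ (measurableSet_cutEvent_sigmaOn (Nat.zero_le _))

theorem measurableSet_strongCutEvent (hY : HasLevelMinLaw p μ Y) (R : ℕ) :
    MeasurableSet (strongCutEvent Y R) :=
  sigmaOn_le hY.measurable _ _ (measurableSet_strongCutEvent_sigmaOn (Nat.zero_le _))

theorem measure_biInter (hY : HasLevelMinLaw p μ Y) (S : Finset ℕ) (r : ℕ → ℕ) :
    μ (⋂ s ∈ S, {ω | r s ≤ Y s ω}) = ENNReal.ofReal (∏ s ∈ S, upProb p (r s) s s) := by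
  have hle : ∀ s ∈ S, s ≤ S.sup id := fun s hs => Finset.le_sup (f := id) hs
  have hset : ⋂ s ∈ S, {ω | r s ≤ Y s ω} =
      {ω | ∀ s ≤ S.sup id, (if s ∈ S then r s else 0) ≤ Y s ω} := by
    ext ω
    simp only [Set.mem_iInter, Set.mem_ofPred_eq]
    constructor
    · intro h s _
      split_ifs with hs
      · exact h s hs
      · exact Nat.zero_le _
    · intro h s hs
      simpa [hs] using h s (hle s hs)
  rw [hset, hY.law]
  congr 1
  rw [← Finset.prod_subset (s₁ := S)]
  · exact Finset.prod_congr rfl fun s hs => by rw [if_pos hs]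
  · intro s hs
    exact Finset.mem_range.2 (Nat.lt_succ_of_le (hle s hs))
  · intro s _ hs
    rw [if_neg hs, upProb_zero]

/-- The upper tails form a generating π-system, and their joint probabilities factor. -/
theorem iIndep (hp : NonnegDrift p) (hY : HasLevelMinLaw p μ Y) :
    iIndep (fun s => MeasurableSpace.comap (Y s) inferInstance) μ := by
  refine iIndepSets.iIndep (fun s => (hY.measurable s).comap_le)
    (fun s => {A | ∃ r, A = {ω | r ≤ Y s ω}}) ?_ ?_ ?_
  · rintro s _ ⟨r, rfl⟩ _ ⟨r', rfl⟩ -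
    exact ⟨max r r', by ext; simp⟩
  · intro s
    rw [BorelSpace.measurable_eq (α := ℕ), borel_eq_generateFrom_Ici,
      MeasurableSpace.comap_generateFrom]
    congr 1
    ext A
    constructor
    · rintro ⟨_, ⟨r, rfl⟩, rfl⟩
      exact ⟨r, rfl⟩
    · rintro ⟨r, rfl⟩
      exact ⟨_, ⟨r, rfl⟩, rfl⟩
  · rw [iIndepSets_iff]
    intro S f hf
    choose! r hr using hf
    have h1 : ⋂ s ∈ S, f s = ⋂ s ∈ S, {ω | r s ≤ Y s ω} :=
      Set.iInter₂_congr fun s hs => hr s hs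
    rw [h1, hY.measure_biInter, ENNReal.ofReal_prod_of_nonneg fun s _ => hp.upProb_nonneg _ _ _]
    refine Finset.prod_congr rfl fun s hs => ?_
    have := hY.measure_biInter {s} r
    simp only [Finset.mem_singleton, Set.iInter_iInter_eq_left, Finset.prod_singleton] at this
    rw [hr s hs, this]

theorem measure_inter_of_disjoint (hp : NonnegDrift p) (hY : HasLevelMinLaw p μ Y) {S T : Set ℕ}
    (hST : Disjoint S T) {A B : Set Ω} (hA : MeasurableSet[sigmaOn Y S] A)
    (hB : MeasurableSet[sigmaOn Y T] B) : μ.real (A ∩ B) = μ.real A * μ.real B := by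
  have := (Indep_iff _ _ μ).1
    (indep_iSup_of_disjoint (fun s => (hY.measurable s).comap_le) (hY.iIndep hp) hST) A B hA hB
  simp only [measureReal_def, this, ENNReal.toReal_mul]

theorem strongCutEvent_infinite_zero_one (hp : NonnegDrift p) (hY : HasLevelMinLaw p μ Y) :
    μ {ω | {R | ω ∈ strongCutEvent Y R}.Infinite} = 0 ∨
      μ {ω | {R | ω ∈ strongCutEvent Y R}.Infinite} = 1 :=
  measure_zero_or_one_of_measurableSet_limsup_atTop (fun s => (hY.measurable s).comap_le)
    (hY.iIndep hp) measurableSet_limsup_strongCutEvent_infinite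

theorem measureReal_biInter (hp : NonnegDrift p) (hY : HasLevelMinLaw p μ Y) (S : Finset ℕ)
    (r : ℕ → ℕ) : μ.real (⋂ s ∈ S, {ω | r s ≤ Y s ω}) = ∏ s ∈ S, upProb p (r s) s s := by
  rw [measureReal_def, hY.measure_biInter,
    ENNReal.toReal_ofReal (Finset.prod_nonneg fun _ _ => hp.upProb_nonneg _ _ _)]

/-- The walk does not return to `r` between the first visits of `r + 1` and `n`. -/
theorem measureReal_no_return (hp : NonnegDrift p) (hY : HasLevelMinLaw p μ Y) {r n : ℕ}
    (h : r < n) : μ.real (⋂ s ∈ Finset.Ioo r n, {ω | r + 1 ≤ Y s ω}) = 1 / DFin p r n := by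
  rw [hY.measureReal_biInter hp _ fun _ => r + 1, hp.prod_upProb h]

/-- The walk visits `r` only once before its first visit of `n`. -/
theorem measureReal_single_visit (hp : NonnegDrift p) (hY : HasLevelMinLaw p μ Y) {r n : ℕ}
    (h : r < n) :
    μ.real ({ω | r ≤ Y r ω} ∩ ⋂ s ∈ Finset.Ioo r n, {ω | r + 1 ≤ Y s ω}) =
      E p r * (1 / DFin p r n) := by
  rw [hY.measure_inter_of_disjoint hp (S := {r}) (T := Set.Ioi r) (by simp)
    (measurableSet_sigmaOn_le (Set.mem_singleton r) r), hY.measureReal_no_return hp h]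
  · have := hY.measureReal_biInter hp {r} fun s => s
    simp only [Finset.mem_singleton, Set.iInter_iInter_eq_left, Finset.prod_singleton,
      hp.upProb_self] at this
    rw [this]
  · exact MeasurableSet.iInter fun s => MeasurableSet.iInter fun hs =>
      measurableSet_sigmaOn_le (Finset.mem_Ioo.1 hs).1 _

/-- Continuity from above, stated as a limit so that it also covers a divergent scale sum, as needed
to exploit transience. -/
theorem tendsto_cutEvent [IsProbabilityMeasure μ] (hp : NonnegDrift p)
    (hY : HasLevelMinLaw p μ Y) (R : ℕ) :
    Tendsto (fun n => 1 / DFin p R n) atTop (𝓝 (μ.real (cutEvent Y R))) := by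
  have h1 : cutEvent Y R = ⋂ n, ⋂ s ∈ Finset.Ioo R n, {ω | R + 1 ≤ Y s ω} := by
    ext ω
    simp only [cutEvent, Set.mem_ofPred_eq, Set.mem_iInter, Finset.mem_Ioo]
    exact ⟨fun h n s hs => h s hs.1, fun h s hs => h (s + 1) s ⟨hs, by omega⟩⟩
  have h2 := tendsto_measure_iInter_atTop (μ := μ)
    (s := fun n => ⋂ s ∈ Finset.Ioo R n, {ω | R + 1 ≤ Y s ω})
    (fun n => (MeasurableSet.iInter fun s => MeasurableSet.iInter fun _ =>
      hY.measurableSet_le _ _).nullMeasurableSet)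
    (fun m n hmn => Set.biInter_mono (fun s hs => by
      simp only [Finset.coe_Ioo, Set.mem_Ioo] at hs ⊢; omega) fun _ _ => subset_rfl)
    ⟨0, measure_ne_top _ _⟩
  rw [← h1] at h2
  have h3 := (ENNReal.tendsto_toReal (measure_ne_top μ (cutEvent Y R))).comp h2
  refine h3.congr' ?_
  filter_upwards [eventually_gt_atTop R] with n hn
  exact hY.measureReal_no_return hp hn

theorem measureReal_cutEvent [IsProbabilityMeasure μ] (hp : NonnegDrift p)
    (hs : Summable (scaleIncr p)) (hY : HasLevelMinLaw p μ Y) (R : ℕ) :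
    μ.real (cutEvent Y R) = 1 / D p R := by
  have hD := tendsto_DFin p hp hs R
  have h1 : 1 ≤ D p R := ge_of_tendsto hD <| by
    filter_upwards [eventually_gt_atTop R] with n hn using hp.one_le_DFin hn
  exact tendsto_nhds_unique (hY.tendsto_cutEvent hp R)
    (tendsto_const_nhds.div hD (by linarith))

theorem measureReal_strongCutEvent [IsProbabilityMeasure μ] (hp : NonnegDrift p)
    (hs : Summable (scaleIncr p)) (hY : HasLevelMinLaw p μ Y) (R : ℕ) :
    μ.real (strongCutEvent Y R) = E p R / D p R := by
  have h := hY.measure_inter_of_disjoint hp (S := {R}) (T := Set.Ici (R + 1)) (by simp)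
    (measurableSet_sigmaOn_le (Set.mem_singleton R) R) (measurableSet_cutEvent_sigmaOn le_rfl)
  have h1 := hY.measureReal_biInter hp {R} fun s => s
  simp only [Finset.mem_singleton, Set.iInter_iInter_eq_left, Finset.prod_singleton,
    hp.upProb_self] at h1
  rw [h1, hY.measureReal_cutEvent hp hs, mul_one_div] at h
  exact h

/-- Renewal structure: if j is a strong cutpoint, all levels from j on automatically stay above i,
so only the levels below j, independent of the event at j, remain to be controlled. -/
theorem measureReal_strongCutEvent_inter [IsProbabilityMeasure μ] (hp : NonnegDrift p)
    (hs : Summable (scaleIncr p)) (hY : HasLevelMinLaw p μ Y) {i j : ℕ} (hij : i < j) :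
    μ.real (strongCutEvent Y i ∩ strongCutEvent Y j) =
      E p i * (1 / DFin p i j) * (E p j / D p j) := by
  have hset : strongCutEvent Y i ∩ strongCutEvent Y j =
      ({ω | i ≤ Y i ω} ∩ ⋂ s ∈ Finset.Ioo i j, {ω | i + 1 ≤ Y s ω}) ∩ strongCutEvent Y j := by
    ext ω
    simp only [strongCutEvent, Set.mem_inter_iff, Set.mem_ofPred_eq, Set.mem_iInter,
      Finset.mem_Ioo]
    constructor
    · rintro ⟨⟨h1, h2⟩, h3⟩
      exact ⟨⟨h1, fun s hs => h2 s hs.1⟩, h3⟩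
    · rintro ⟨⟨h1, h2⟩, h3, h4⟩
      refine ⟨⟨h1, fun s hs => ?_⟩, h3, h4⟩
      rcases lt_trichotomy s j with h | rfl | h
      · exact h2 s ⟨hs, h⟩
      · exact hij.trans_le h3
      · exact hij.trans (h4 s h)
  rw [hset, hY.measure_inter_of_disjoint hp (S := Set.Iio j) (T := Set.Ici j)
    (Set.disjoint_left.2 fun _ h h' => absurd (Set.mem_Ici.1 h') (not_le.2 h)) ?_
    (measurableSet_strongCutEvent_sigmaOn le_rfl), hY.measureReal_single_visit hp hij,
    hY.measureReal_strongCutEvent hp hs]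
  refine (measurableSet_sigmaOn_le (Set.mem_Iio.2 hij) i).inter ?_
  exact MeasurableSet.iInter fun s => MeasurableSet.iInter fun h =>
    measurableSet_sigmaOn_le (Set.mem_Iio.2 (Finset.mem_Ioo.1 h).2) _

end HasLevelMinLaw

/-! ### Transience gives a finite scale sum -/

section Chain

variable {Ω : Type*} [MeasurableSpace Ω] {μ : Measure Ω} {p : ℕ → ℝ} {X : ℕ → Ω → ℕ}

theorem measure_eq_one_of_ae [IsProbabilityMeasure μ] {q : Ω → Prop} (h : ∀ᵐ ω ∂μ, q ω) :
    μ {ω | q ω} = 1 := by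
  rw [measure_congr (eventuallyEq_univ.2 h), measure_univ]

theorem IsMarkovChain.hasLevelMinLaw [IsProbabilityMeasure μ] (hp : NonnegDrift p)
    (hX : IsMarkovChain μ (step p) X) :
    HasLevelMinLaw p μ fun s ω => levelMin (fun k => X k ω) s :=
  ⟨measurable_levelMin hX.measurable, hX.measure_forall_le_levelMin hp⟩

/-- If the sum diverged, 0 would almost surely not be a cutpoint, so the walk would almost surely
return to 0. -/
theorem IsMarkovChain.summable_scaleIncr [IsProbabilityMeasure μ] (hp : NonnegDrift p)
    (hX : IsMarkovChain μ (step p) X) (htrans : IsTransient μ X) : Summable (scaleIncr p) := by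
  by_contra hns
  have hY := hX.hasLevelMinLaw hp
  have hD : Tendsto (DFin p 0) atTop atTop := by
    have := (not_summable_iff_tendsto_nat_atTop_of_nonneg fun n => (hp.scaleIncr_pos n).le).1 hns
    refine this.congr fun n => ?_
    rw [hp.DFin_eq, scaleIncr_zero, div_one, Finset.range_eq_Ico]
  have h0 := tendsto_nhds_unique (hY.tendsto_cutEvent hp 0)
    (by simp only [one_div]; exact tendsto_inv_atTop_zero.comp hD)
  rw [measureReal_eq_zero_iff] at h0
  have hret : ∀ᵐ ω ∂μ, ∃ n, 0 < n ∧ X n ω = 0 := by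
    have : ∀ᵐ ω ∂μ, ω ∉ cutEvent (fun s ω => levelMin (fun k => X k ω) s) 0 := by
      rwa [← measure_eq_zero_iff_ae_notMem]
    filter_upwards [this, hX.ae_isUnboundedPath hp] with ω h1 h2
    by_contra! hcon
    refine h1 fun s hs => h2.le_levelMin_iff.2 fun i hi => ?_
    rcases Nat.eq_zero_or_pos i with rfl | hi0
    · rw [partialSups_zero, h2.start] at hi
      omega
    · exact Nat.pos_of_ne_zero (hcon i hi0)
  have hstart : μ {ω | X 0 ω = 0} = 1 := measure_eq_one_of_ae hX.start
  have hlt := htrans 0 0 (by rw [hstart]; exact one_ne_zero)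
  have hm : MeasurableSet {ω | X 0 ω = 0} := hX.measurable 0 (measurableSet_singleton 0)
  rw [cond_apply hm, hstart, inv_one, one_mul] at hlt
  refine hlt.ne (measure_eq_one_of_ae ?_)
  filter_upwards [hX.start, hret] with ω h1 h2 using ⟨h1, h2⟩

end Chain

/-! ### Part (a): finitely many cutpoints -/

theorem log_succ_le_sum_inv_rev (l n : ℕ) :
    Real.log (n + 1) ≤ ∑ i ∈ Finset.Ico l (l + n), 1 / (((l + n : ℕ) : ℝ) - i) := by
  have h : ∑ i ∈ Finset.Ico l (l + n), 1 / (((l + n : ℕ) : ℝ) - i) = (harmonic n : ℝ) := by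
    rw [Finset.sum_Ico_eq_sum_range, Nat.add_sub_cancel_left,
      ← Finset.sum_range_reflect, harmonic]
    push_cast
    refine Finset.sum_congr rfl fun k hk => ?_
    have hk : k < n := Finset.mem_range.1 hk
    rw [show n - 1 - k = n - (k + 1) by omega, Nat.cast_sub (by omega), one_div]
    congr 1
    push_cast
    ring
  rw [h]
  exact_mod_cast log_add_one_le_harmonic n

section LastCut

variable {Ω : Type*} {Y : ℕ → Ω → ℕ}

/-- The event that `j` is the last cutpoint before `b`. -/
def lastCutEvent (Y : ℕ → Ω → ℕ) (b j : ℕ) : Set Ω :=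
  cutEvent Y j \ ⋃ k ∈ Finset.Ioo j b, cutEvent Y k

theorem measurableSet_lastCutEvent_sigmaOn (b j : ℕ) :
    MeasurableSet[sigmaOn Y (Set.Ici (j + 1))] (lastCutEvent Y b j) :=
  MeasurableSet.diff (measurableSet_cutEvent_sigmaOn le_rfl)
    (MeasurableSet.iUnion fun k => MeasurableSet.iUnion fun hk =>
      measurableSet_cutEvent_sigmaOn (by have := (Finset.mem_Ioo.1 hk).1; omega))

theorem pairwiseDisjoint_lastCutEvent (a b : ℕ) :
    (Finset.Ico a b : Set ℕ).PairwiseDisjoint (lastCutEvent Y b) := by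
  have key : ∀ i j : ℕ, i < j → j ∈ Finset.Ico a b →
      Disjoint (lastCutEvent Y b i) (lastCutEvent Y b j) := by
    intro i j hij hj
    refine Set.disjoint_left.2 fun ω hi hj' => hi.2 ?_
    exact Set.mem_biUnion (Finset.mem_Ioo.2 ⟨hij, (Finset.mem_Ico.1 hj).2⟩) hj'.1
  intro i hi j hj hij
  rcases hij.lt_or_gt with h | h
  · exact key i j h hj
  · exact (key j i h hi).symm

theorem biUnion_cutEvent_subset (a b : ℕ) :
    ⋃ j ∈ Finset.Ico a b, cutEvent Y j ⊆ ⋃ j ∈ Finset.Ico a b, lastCutEvent Y b j := by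
  classical
  intro ω hω
  have hne : ((Finset.Ico a b).filter fun j => ω ∈ cutEvent Y j).Nonempty := by
    obtain ⟨j, hj, hω⟩ := Set.mem_iUnion₂.1 hω
    exact ⟨j, Finset.mem_filter.2 ⟨hj, hω⟩⟩
  obtain ⟨h1, h2⟩ := Finset.mem_filter.1 (Finset.max'_mem _ hne)
  refine Set.mem_biUnion h1 ⟨h2, fun h => ?_⟩
  obtain ⟨k, hk, hk2⟩ := Set.mem_iUnion₂.1 h
  rw [Finset.mem_Ioo] at hk
  have := Finset.le_max' ((Finset.Ico a b).filter fun j => ω ∈ cutEvent Y j) k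
    (Finset.mem_filter.2 ⟨Finset.mem_Ico.2 ⟨(Finset.mem_Ico.1 h1).1.trans hk.1.le, hk.2⟩, hk2⟩)
  omega

end LastCut

section Finite

variable {Ω : Type*} [MeasurableSpace Ω] {μ : Measure Ω} {p : ℕ → ℝ} {Y : ℕ → Ω → ℕ}

/-- Once j is a cutpoint, only the levels in (i, j] matter for i, while the last-cutpoint event
depends on levels above j; independence gives the factor 1/D(i, j+1). -/
theorem HasLevelMinLaw.measureReal_cutEvent_inter_lastCutEvent (hp : NonnegDrift p)
    (hY : HasLevelMinLaw p μ Y) {b i j : ℕ} (hij : i ≤ j) :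
    1 / (((j + 1 : ℕ) : ℝ) - i) * μ.real (lastCutEvent Y b j) ≤
      μ.real (cutEvent Y i ∩ lastCutEvent Y b j) := by
  have hset : cutEvent Y i ∩ lastCutEvent Y b j =
      (⋂ s ∈ Finset.Ioo i (j + 1), {ω | i + 1 ≤ Y s ω}) ∩ lastCutEvent Y b j := by
    ext ω
    simp only [Set.mem_inter_iff, and_congr_left_iff]
    intro hω
    simp only [cutEvent, Set.mem_ofPred_eq, Set.mem_iInter, Finset.mem_Ioo]
    refine ⟨fun h s hs => h s hs.1, fun h s hs => ?_⟩
    rcases le_or_gt s j with hsj | hsj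
    · exact h s ⟨hs, by omega⟩
    · exact hij.trans_lt (hω.1 s hsj)
  rw [hset, hY.measure_inter_of_disjoint hp (S := Set.Iio (j + 1)) (T := Set.Ici (j + 1))
    (Set.disjoint_left.2 fun _ h h' => absurd (Set.mem_Ici.1 h') (not_le.2 h)) ?_
    (measurableSet_lastCutEvent_sigmaOn b j), hY.measureReal_no_return hp (by omega)]
  · refine mul_le_mul_of_nonneg_right ?_ measureReal_nonneg
    exact one_div_le_one_div_of_le (by linarith [hp.one_le_DFin (show i < j + 1 by omega)])
      (hp.DFin_le_sub (by omega))
  · exact MeasurableSet.iInter fun s => MeasurableSet.iInter fun h =>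
      measurableSet_sigmaOn_le (Set.mem_Iio.2 (Finset.mem_Ioo.1 h).2) _

/-- Given a cutpoint in `[a, b)`, the expected number of cutpoints in `[l, b)` is at least
`log (a - l + 1)`. -/
theorem HasLevelMinLaw.log_mul_measureReal_le [IsProbabilityMeasure μ] (hp : NonnegDrift p)
    (hs : Summable (scaleIncr p)) (hY : HasLevelMinLaw p μ Y) {l a b : ℕ} (hla : l ≤ a) :
    Real.log ((a - l : ℕ) + 1) * μ.real (⋃ j ∈ Finset.Ico a b, cutEvent Y j) ≤
      ∑ i ∈ Finset.Ico l b, 1 / D p i := by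
  have hm : ∀ j, MeasurableSet (lastCutEvent Y b j) := fun j =>
    sigmaOn_le hY.measurable _ _ (measurableSet_lastCutEvent_sigmaOn b j)
  calc Real.log ((a - l : ℕ) + 1) * μ.real (⋃ j ∈ Finset.Ico a b, cutEvent Y j)
      ≤ Real.log ((a - l : ℕ) + 1) * ∑ j ∈ Finset.Ico a b, μ.real (lastCutEvent Y b j) := by
        refine mul_le_mul_of_nonneg_left ?_ (Real.log_nonneg (by simp))
        exact (measureReal_mono (biUnion_cutEvent_subset a b) (measure_ne_top μ _)).trans
          (measureReal_biUnion_finset_le _ _)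
    _ ≤ ∑ j ∈ Finset.Ico a b, ∑ i ∈ Finset.Ico l b,
          μ.real (cutEvent Y i ∩ lastCutEvent Y b j) := by
        rw [Finset.mul_sum]
        refine Finset.sum_le_sum fun j hj => ?_
        obtain ⟨haj, hjb⟩ := Finset.mem_Ico.1 hj
        obtain ⟨n, hn⟩ : ∃ n, j + 1 = l + n := ⟨j + 1 - l, by omega⟩
        calc Real.log ((a - l : ℕ) + 1) * μ.real (lastCutEvent Y b j)
            ≤ (∑ i ∈ Finset.Ico l (j + 1), 1 / (((j + 1 : ℕ) : ℝ) - i)) *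
                μ.real (lastCutEvent Y b j) := by
              refine mul_le_mul_of_nonneg_right ?_ measureReal_nonneg
              rw [hn]
              refine (Real.log_le_log (by positivity) ?_).trans (log_succ_le_sum_inv_rev l n)
              have : a - l ≤ n := by omega
              gcongr
          _ ≤ ∑ i ∈ Finset.Ico l (j + 1), μ.real (cutEvent Y i ∩ lastCutEvent Y b j) := by
              rw [Finset.sum_mul]
              refine Finset.sum_le_sum fun i hi => ?_
              exact hY.measureReal_cutEvent_inter_lastCutEvent hp
                (Nat.lt_succ_iff.1 (Finset.mem_Ico.1 hi).2)
          _ ≤ _ := Finset.sum_le_sum_of_subset_of_nonneg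
              (Finset.Ico_subset_Ico_right (by omega)) fun _ _ _ => measureReal_nonneg
    _ = ∑ i ∈ Finset.Ico l b, ∑ j ∈ Finset.Ico a b,
          μ.real (cutEvent Y i ∩ lastCutEvent Y b j) := Finset.sum_comm
    _ ≤ ∑ i ∈ Finset.Ico l b, 1 / D p i := by
        refine Finset.sum_le_sum fun i _ => ?_
        -- For fixed i the events that j is last are disjoint, so they add up to at most the
        -- probability 1/D(i) of a cutpoint at i.
        rw [← measureReal_biUnion_finset
          ((pairwiseDisjoint_lastCutEvent a b).mono fun j => Set.inter_subset_right)
          fun j _ => (hY.measurableSet_cutEvent i).inter (hm j),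
          ← hY.measureReal_cutEvent hp hs]
        exact measureReal_mono (Set.iUnion₂_subset fun j _ => Set.inter_subset_left)

theorem summable_dyadic_blocks {g : ℕ → ℝ} (hg : Summable g) (hg0 : ∀ n, 0 ≤ g n) :
    Summable fun m : ℕ => ∑ i ∈ Finset.Ico (2 ^ m) (2 ^ (m + 1)), g i := by
  have h : ∀ K, ∑ m ∈ Finset.range K, ∑ i ∈ Finset.Ico (2 ^ m) (2 ^ (m + 1)), g i =
      ∑ i ∈ Finset.Ico 1 (2 ^ K), g i := by
    intro K
    induction K with
    | zero => simp
    | succ K ih =>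
      rw [Finset.sum_range_succ, ih, Finset.sum_Ico_consecutive _ Nat.one_le_two_pow
        (Nat.pow_le_pow_right (by norm_num) (by omega))]
  refine summable_of_sum_range_le (c := ∑' i, g i) (fun m => Finset.sum_nonneg fun _ _ => hg0 _)
    fun K => ?_
  rw [h]
  exact hg.sum_le_tsum _ fun _ _ => hg0 _

theorem NonnegDrift.one_le_D (hp : NonnegDrift p) (hs : Summable (scaleIncr p)) (m : ℕ) :
    1 ≤ D p m :=
  ge_of_tendsto (tendsto_DFin p hp hs m) <| by
    filter_upwards [eventually_gt_atTop m] with n hn using hp.one_le_DFin hn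

theorem HasLevelMinLaw.ae_finite_cutEvent [IsProbabilityMeasure μ] (hp : NonnegDrift p)
    (hs : Summable (scaleIncr p)) (hY : HasLevelMinLaw p μ Y)
    (hsum : Summable fun n : ℕ => 1 / (D p (n + 2) * Real.log ((n + 2 : ℕ) : ℝ))) :
    ∀ᵐ ω ∂μ, {R | ω ∈ cutEvent Y R}.Finite := by
  -- The terms n = 0, 1 are 0, since `Real.log` vanishes there.
  let g : ℕ → ℝ := fun n => 1 / (D p n * Real.log n)
  have hg : Summable g := (summable_nat_add_iff 2).1 hsum
  have hDpos : ∀ n, 0 < D p n := fun n => zero_lt_one.trans_le (hp.one_le_D hs n)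
  have hg0 : ∀ n, 0 ≤ g n := fun n =>
    div_nonneg zero_le_one (mul_nonneg (hDpos n).le (Real.log_natCast_nonneg n))
  let A : ℕ → Set Ω := fun m => ⋃ j ∈ Finset.Ico (2 ^ (m + 2)) (2 ^ (m + 3)), cutEvent Y j
  have hl2 : 0 < Real.log 2 := Real.log_pos (by norm_num)
  -- Starting the window one block early gives the factor (m + 1) log 2 on the left, while log i ≤
  -- (m + 3) log 2 on it; 3 bounds (m + 3)/(m + 1).
  have hA : ∀ m, μ.real (A m) ≤ 3 * (∑ i ∈ Finset.Ico (2 ^ (m + 1)) (2 ^ (m + 2)), g i +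
      ∑ i ∈ Finset.Ico (2 ^ (m + 2)) (2 ^ (m + 3)), g i) := by
    intro m
    have h1 := hY.log_mul_measureReal_le hp hs (l := 2 ^ (m + 1)) (a := 2 ^ (m + 2))
      (b := 2 ^ (m + 3)) (Nat.pow_le_pow_right (by norm_num) (by omega))
    have h2 : ((m : ℝ) + 1) * Real.log 2 ≤
        Real.log ((2 ^ (m + 2) - 2 ^ (m + 1) : ℕ) + 1) := by
      rw [show 2 ^ (m + 2) - 2 ^ (m + 1) = 2 ^ (m + 1) by rw [pow_succ 2 (m + 1)]; omega]
      have : ((m : ℝ) + 1) * Real.log 2 = Real.log ((2 ^ (m + 1) : ℕ) : ℝ) := by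
        push_cast; rw [Real.log_pow]; push_cast; ring
      rw [this]
      exact Real.log_le_log (by positivity) (by linarith)
    have h3 : ∑ i ∈ Finset.Ico (2 ^ (m + 1)) (2 ^ (m + 3)), 1 / D p i ≤
        ∑ i ∈ Finset.Ico (2 ^ (m + 1)) (2 ^ (m + 3)), ((m : ℝ) + 3) * Real.log 2 * g i := by
      refine Finset.sum_le_sum fun i hi => ?_
      obtain ⟨hi1, hi2⟩ := Finset.mem_Ico.1 hi
      have hi0 : 1 < i := lt_of_lt_of_le (Nat.one_lt_two_pow (by omega)) hi1
      have hlog : 0 < Real.log i := Real.log_pos (by exact_mod_cast hi0)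
      have hlog2 : Real.log i ≤ ((m : ℝ) + 3) * Real.log 2 := by
        have : ((m : ℝ) + 3) * Real.log 2 = Real.log ((2 ^ (m + 3) : ℕ) : ℝ) := by
          push_cast; rw [Real.log_pow]; push_cast; ring
        rw [this]
        exact Real.log_le_log (by positivity) (by exact_mod_cast hi2.le)
      have := hDpos i
      simp only [g]
      rw [mul_one_div, div_le_div_iff₀ this (mul_pos this hlog)]
      nlinarith
    rw [← Finset.mul_sum, ← Finset.sum_Ico_consecutive g
      (Nat.pow_le_pow_right (by norm_num) (by omega : m + 1 ≤ m + 2))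
      (Nat.pow_le_pow_right (by norm_num) (by omega : m + 2 ≤ m + 3))] at h3
    set G := ∑ i ∈ Finset.Ico (2 ^ (m + 1)) (2 ^ (m + 2)), g i +
      ∑ i ∈ Finset.Ico (2 ^ (m + 2)) (2 ^ (m + 3)), g i
    have hG0 : 0 ≤ G := add_nonneg (Finset.sum_nonneg fun _ _ => hg0 _)
      (Finset.sum_nonneg fun _ _ => hg0 _)
    have h4 : ((m : ℝ) + 1) * Real.log 2 * μ.real (A m) ≤ ((m : ℝ) + 3) * Real.log 2 * G :=
      (mul_le_mul_of_nonneg_right h2 measureReal_nonneg).trans (h1.trans h3)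
    have h5 : ((m : ℝ) + 1) * Real.log 2 * μ.real (A m) ≤
        ((m : ℝ) + 1) * Real.log 2 * (3 * G) := by
      refine h4.trans ?_
      have : 0 ≤ (m : ℝ) := Nat.cast_nonneg m
      have : 0 ≤ (m : ℝ) * (Real.log 2 * G) := by positivity
      nlinarith
    exact le_of_mul_le_mul_left h5 (by positivity)
  have hblocks := summable_dyadic_blocks hg hg0
  have hsumA : Summable fun m => μ.real (A m) :=
    Summable.of_nonneg_of_le (fun _ => measureReal_nonneg) hA
      ((((summable_nat_add_iff 1).2 hblocks).add ((summable_nat_add_iff 2).2 hblocks)).mul_left 3)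
  have hne : ∑' m, μ (A m) ≠ ∞ := by
    have h := hsumA.tsum_ofReal_ne_top
    rwa [tsum_congr fun m => ofReal_measureReal (measure_ne_top μ (A m))] at h
  filter_upwards [ae_eventually_notMem hne] with ω hω
  obtain ⟨m₀, hm₀⟩ := eventually_atTop.1 hω
  refine (Set.finite_Iio (2 ^ (m₀ + 2))).subset fun R hR => ?_
  by_contra hcon
  have hR2 : 2 ^ (m₀ + 2) ≤ R := not_lt.1 hcon
  have hR0 : R ≠ 0 := by have := Nat.one_le_two_pow (n := m₀ + 2); omega
  have hlog : m₀ + 2 ≤ Nat.log 2 R := Nat.le_log_of_pow_le (by norm_num) hR2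
  obtain ⟨m, hm⟩ : ∃ m, Nat.log 2 R = m + 2 := ⟨Nat.log 2 R - 2, by omega⟩
  refine hm₀ m (by omega) (Set.mem_biUnion (Finset.mem_Ico.2 ⟨?_, ?_⟩) hR)
  · rw [← hm]; exact Nat.pow_log_le_self 2 hR0
  · have := Nat.lt_pow_succ_log_self (b := 2) (by norm_num) R
    rwa [hm] at this

end Finite

/-! ### Comparing D(m) with D(m, n) -/

section Escape

variable {p : ℕ → ℝ}

theorem NonnegDrift.D_eq_DFin_add (hp : NonnegDrift p) (hs : Summable (scaleIncr p)) {m n : ℕ}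
    (h : m ≤ n) : D p m = DFin p m n + scaleIncr p n / scaleIncr p m * D p n := by
  refine tendsto_nhds_unique (tendsto_DFin p hp hs m)
    ((((tendsto_DFin p hp hs n).const_mul _).const_add _).congr' ?_)
  filter_upwards [eventually_ge_atTop n] with N hN
  have h1 := (hp.scaleIncr_pos m).ne'
  have h2 := (hp.scaleIncr_pos n).ne'
  rw [hp.DFin_eq, hp.DFin_eq n, hp.DFin_eq m N, ← Finset.sum_Ico_consecutive _ h hN]
  field_simp

theorem NonnegDrift.D_pos (hp : NonnegDrift p) (hs : Summable (scaleIncr p)) (m : ℕ) :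
    0 < D p m := zero_lt_one.trans_le (hp.one_le_D hs m)

/-- Decreasing increments make D(m, n) at least n - m times the normalised increment at n. The
factor D(n) in the bound later cancels against the probability E_n/D(n). -/
theorem NonnegDrift.D_div_DFin_le (hp : NonnegDrift p) (hs : Summable (scaleIncr p)) {m n : ℕ}
    (h : m < n) : D p m / DFin p m n ≤ 1 + D p n / ((n : ℝ) - m) := by
  have hF : 0 < DFin p m n := zero_lt_one.trans_le (hp.one_le_DFin h)
  have hnm : (0 : ℝ) < (n : ℝ) - m := sub_pos.2 (by exact_mod_cast h)
  have hW : ((n : ℝ) - m) * (scaleIncr p n / scaleIncr p m) ≤ DFin p m n := by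
    rw [hp.DFin_eq, ← mul_div_assoc]
    refine div_le_div_of_nonneg_right ?_ (hp.scaleIncr_pos m).le
    have := Finset.card_nsmul_le_sum (Finset.Ico m n) (scaleIncr p) (scaleIncr p n)
      fun i hi => hp.scaleIncr_antitone (Finset.mem_Ico.1 hi).2.le
    rwa [Nat.card_Ico, nsmul_eq_mul, Nat.cast_sub h.le] at this
  rw [hp.D_eq_DFin_add hs h.le, add_div, div_self hF.ne']
  refine add_le_add le_rfl ?_
  rw [div_le_div_iff₀ hF hnm]
  nlinarith [hp.D_pos hs n]

/-- The tail of the scale sum from l is D(l) times the increment at l, so passing from l to l + 1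
multiplies the tail by 1 - 1/D(l). -/
theorem NonnegDrift.D_sub_DFin_eq_prod (hp : NonnegDrift p) (hs : Summable (scaleIncr p))
    {m n : ℕ} (h : m ≤ n) :
    D p m - DFin p m n = D p m * ∏ l ∈ Finset.Ico m n, (1 - 1 / D p l) := by
  induction n, h using Nat.le_induction with
  | base => simp [DFin_of_le p le_rfl]
  | succ n hn ih =>
    rw [Finset.prod_Ico_succ_top hn, ← mul_assoc, ← ih, hp.DFin_succ_right hn]
    have h1 := hp.D_eq_DFin_add hs hn
    have h2 := (hp.D_pos hs n).ne'
    have h3 : D p m - DFin p m n = scaleIncr p n / scaleIncr p m * D p n := by linarith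
    rw [h3, ← sub_sub, h3]
    field_simp

theorem loglog_sub_le_sum {m n : ℕ} (hm : 2 ≤ m) (h : m ≤ n) :
    Real.log (Real.log n) - Real.log (Real.log m) ≤
      ∑ l ∈ Finset.Ico m n, 1 / ((l : ℝ) * Real.log l) := by
  induction n, h using Nat.le_induction with
  | base => simp
  | succ n hn ih =>
    rw [Finset.sum_Ico_succ_top hn]
    have hn1 : (1 : ℝ) < n := by exact_mod_cast (by omega : 1 < n)
    have hl : 0 < Real.log n := Real.log_pos hn1
    have hl' : 0 < Real.log ((n + 1 : ℕ) : ℝ) := Real.log_pos (by push_cast; linarith)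
    have h1 : Real.log ((n + 1 : ℕ) : ℝ) - Real.log n ≤ 1 / n := by
      rw [← Real.log_div (by positivity) (by positivity)]
      refine (Real.log_le_sub_one_of_pos (by positivity)).trans_eq ?_
      push_cast
      field_simp
      ring
    have h2 : Real.log (Real.log ((n + 1 : ℕ) : ℝ)) - Real.log (Real.log n) ≤
        1 / ((n : ℝ) * Real.log n) := by
      rw [← Real.log_div hl'.ne' hl.ne']
      refine (Real.log_le_sub_one_of_pos (by positivity)).trans ?_
      rw [← div_div, div_sub_one hl.ne']
      exact div_le_div_of_nonneg_right h1 hl.le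
    linarith

/-- Under the growth bound on `D`, the probabilities that the walk from `m + 1` never returns to
`m`, and that it does not return before reaching `m ^ 2`, are comparable. -/
theorem NonnegDrift.D_div_DFin_le_of_sq_le (hp : NonnegDrift p) (hs : Summable (scaleIncr p))
    {δ : ℝ} (hδ : 0 < δ) {n₀ : ℕ}
    (hD : ∀ n : ℕ, n₀ ≤ n → D p n ≤ δ * (n : ℝ) * Real.log (n : ℝ)) {m n : ℕ} (hm : 2 ≤ m)
    (hm0 : n₀ ≤ m) (h : m ^ 2 ≤ n) :
    D p m / DFin p m n ≤ 1 / (1 - Real.exp (-(Real.log 2 / δ))) := by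
  have hmn : m < n := by nlinarith
  have hF : 0 < DFin p m n := zero_lt_one.trans_le (hp.one_le_DFin hmn)
  have hlt : Real.exp (-(Real.log 2 / δ)) < 1 := by
    rw [Real.exp_lt_one_iff, neg_lt_zero]
    exact div_pos (Real.log_pos (by norm_num)) hδ
  rw [div_le_div_iff₀ hF (by linarith), one_mul]
  have hm1 : (1 : ℝ) < m := by exact_mod_cast (by omega : 1 < m)
  have hlm : 0 < Real.log m := Real.log_pos hm1
  have hsum : Real.log 2 / δ ≤ ∑ l ∈ Finset.Ico m n, 1 / D p l := by
    -- Squaring doubles the logarithm and so adds log 2 to log log: hence the threshold m ^ 2.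
    have h1 : Real.log 2 ≤ ∑ l ∈ Finset.Ico m n, 1 / ((l : ℝ) * Real.log l) := by
      refine le_trans ?_ (loglog_sub_le_sum hm hmn.le)
      have h2 : 2 * Real.log m ≤ Real.log n := by
        have : 2 * Real.log m = Real.log ((m ^ 2 : ℕ) : ℝ) := by
          push_cast; rw [Real.log_pow]; push_cast; ring
        rw [this]
        exact Real.log_le_log (by positivity) (by exact_mod_cast h)
      have h3 := Real.log_le_log (by positivity) h2
      rw [Real.log_mul (by norm_num) hlm.ne'] at h3
      linarith
    rw [div_eq_mul_one_div, mul_comm]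
    refine (mul_le_mul_of_nonneg_left h1 (by positivity)).trans ?_
    rw [Finset.mul_sum]
    refine Finset.sum_le_sum fun l hl => ?_
    have hl := (Finset.mem_Ico.1 hl).1
    rw [one_div_mul_one_div, ← mul_assoc]
    exact one_div_le_one_div_of_le (hp.D_pos hs l) (hD l (hm0.trans hl))
  have hprod : ∏ l ∈ Finset.Ico m n, (1 - 1 / D p l) ≤ Real.exp (-(Real.log 2 / δ)) := by
    calc ∏ l ∈ Finset.Ico m n, (1 - 1 / D p l)
        ≤ ∏ l ∈ Finset.Ico m n, Real.exp (-(1 / D p l)) := by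
          refine Finset.prod_le_prod (fun l _ => ?_) fun l _ => Real.one_sub_le_exp_neg _
          rw [sub_nonneg, div_le_one (hp.D_pos hs l)]
          exact hp.one_le_D hs l
      _ = Real.exp (-∑ l ∈ Finset.Ico m n, 1 / D p l) := by
          rw [← Real.exp_sum, Finset.sum_neg_distrib]
      _ ≤ _ := Real.exp_le_exp.2 (neg_le_neg hsum)
  have h4 := hp.D_sub_DFin_eq_prod hs hmn.le
  nlinarith [mul_le_mul_of_nonneg_left hprod (hp.D_pos hs m).le]

end Escape

/-! ### Weighted second moment method -/

section SecondMoment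

variable {Ω : Type*} [MeasurableSpace Ω] {μ : Measure Ω} [IsProbabilityMeasure μ]

/-- A weighted second moment criterion for infinitely many events to occur. -/
theorem not_ae_finite_of_second_moment {S : ℕ → Set Ω} (hS : ∀ R, MeasurableSet (S R))
    {w : ℕ → ℝ} (hw : ∀ R, 0 ≤ w R)
    (hdiv : Tendsto (fun N => ∑ R ∈ Finset.range N, w R * μ.real (S R)) atTop atTop) {K : ℝ}
    (hK : ∀ N, ∑ i ∈ Finset.range N, ∑ j ∈ Finset.range N, w i * w j * μ.real (S i ∩ S j) ≤
      K * ((∑ R ∈ Finset.range N, w R * μ.real (S R)) ^ 2 +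
        ∑ R ∈ Finset.range N, w R * μ.real (S R))) :
    ¬ ∀ᵐ ω ∂μ, {R | ω ∈ S R}.Finite := by
  intro hfin
  let Z : ℕ → Ω → ℝ := fun N ω => ∑ R ∈ Finset.range N, w R * (S R).indicator 1 ω
  have hintS : ∀ A : Set Ω, MeasurableSet A → Integrable (A.indicator (1 : Ω → ℝ)) μ :=
    fun A hA => (integrable_const (1 : ℝ)).indicator hA
  have hZm : ∀ N, Measurable (Z N) := fun N =>
    Finset.measurable_sum _ fun R _ => (measurable_one.indicator (hS R)).const_mul _
  have hZint : ∀ N, Integrable (Z N) μ := fun N =>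
    integrable_finsetSum _ fun R _ => (hintS _ (hS R)).const_mul _
  have hZmean : ∀ N, ∫ ω, Z N ω ∂μ = ∑ R ∈ Finset.range N, w R * μ.real (S R) := by
    intro N
    rw [integral_finsetSum _ fun R _ => (hintS _ (hS R)).const_mul _]
    refine Finset.sum_congr rfl fun R _ => ?_
    rw [integral_const_mul, integral_indicator_one (hS R)]
  have hZsq : ∀ N, (fun ω => Z N ω ^ 2) = fun ω => ∑ i ∈ Finset.range N, ∑ j ∈ Finset.range N,
      w i * w j * (S i ∩ S j).indicator 1 ω := by
    intro N
    ext ω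
    rw [sq, Finset.sum_mul_sum]
    refine Finset.sum_congr rfl fun i _ => Finset.sum_congr rfl fun j _ => ?_
    rw [Set.inter_indicator_one, Pi.mul_apply]
    ring
  have hint2 : ∀ N, Integrable (fun ω => Z N ω ^ 2) μ := by
    intro N
    rw [hZsq]
    exact integrable_finsetSum _ fun i _ => integrable_finsetSum _ fun j _ =>
      (hintS _ ((hS i).inter (hS j))).const_mul _
  have hZ2 : ∀ N, ∫ ω, Z N ω ^ 2 ∂μ =
      ∑ i ∈ Finset.range N, ∑ j ∈ Finset.range N, w i * w j * μ.real (S i ∩ S j) := by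
    intro N
    rw [hZsq, integral_finsetSum _ fun i _ => integrable_finsetSum _ fun j _ =>
      (hintS _ ((hS i).inter (hS j))).const_mul _]
    refine Finset.sum_congr rfl fun i _ => ?_
    rw [integral_finsetSum _ fun j _ => (hintS _ ((hS i).inter (hS j))).const_mul _]
    refine Finset.sum_congr rfl fun j _ => ?_
    rw [integral_const_mul, integral_indicator_one ((hS i).inter (hS j))]
  -- If only finitely many events occur, the weighted count is bounded, so these events decrease to
  -- a null set.
  let B : ℕ → Set Ω := fun M => {ω | ∃ N, (M : ℝ) < Z N ω}
  have hBm : ∀ M, MeasurableSet (B M) := fun M => by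
    simp only [B, Set.ofPred_exists]
    exact MeasurableSet.iUnion fun N => hZm N measurableSet_Ioi
  have hBlim : Tendsto (fun M => μ.real (B M)) atTop (𝓝 0) := by
    have h := tendsto_measure_iInter_atTop (μ := μ) (s := B)
      (fun M => (hBm M).nullMeasurableSet)
      (fun M M' hM ω ⟨N, hN⟩ => ⟨N, lt_of_le_of_lt (Nat.cast_le.2 hM) hN⟩)
      ⟨0, measure_ne_top _ _⟩
    have h0 : μ (⋂ M, B M) = 0 := by
      rw [measure_eq_zero_iff_ae_notMem]
      filter_upwards [hfin] with ω hω hcon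
      obtain ⟨M, hM⟩ := exists_nat_ge (∑ R ∈ hω.toFinset, w R)
      obtain ⟨N, hN⟩ := Set.mem_iInter.1 hcon M
      refine absurd (hN.trans_le ?_) (not_lt.2 hM)
      calc Z N ω ≤ ∑ R ∈ Finset.range N, if R ∈ hω.toFinset then w R else 0 := by
            refine Finset.sum_le_sum fun R _ => ?_
            by_cases hR : ω ∈ S R <;> simp [hR]
        _ ≤ ∑ R ∈ hω.toFinset, w R := by
            rw [← Finset.sum_filter]
            refine Finset.sum_le_sum_of_subset_of_nonneg (fun R hR => (Finset.mem_filter.1 hR).2)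
              fun R _ _ => hw R
    rw [h0] at h
    exact (ENNReal.tendsto_toReal ENNReal.zero_ne_top).comp h
  let K' := max K 1
  have hK' : 1 ≤ K' := le_max_right _ _
  obtain ⟨M, hM⟩ := (hBlim.eventually (gt_mem_nhds (show 0 < 1 / (8 * K') by positivity))).exists
  obtain ⟨N, hN1, hN2⟩ := ((hdiv.eventually_ge_atTop 1).and
    (hdiv.eventually_gt_atTop (2 * M))).exists
  rw [← hZmean] at hN1 hN2
  have hsm := hK N
  rw [← hZ2, ← hZmean] at hsm
  set m := ∫ ω, Z N ω ∂μ with hm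
  have hsm' : ∫ ω, Z N ω ^ 2 ∂μ ≤ 2 * K' * m ^ 2 := by
    refine hsm.trans ?_
    have h1 : K * (m ^ 2 + m) ≤ K' * (m ^ 2 + m) :=
      mul_le_mul_of_nonneg_right (le_max_left _ _) (by positivity)
    have h2 : K' * m ≤ K' * m ^ 2 := mul_le_mul_of_nonneg_left (by nlinarith) (by linarith)
    linarith
  -- AM-GM on B, trivial off B. After integration the last two terms are at most m/4 each, which
  -- contradicts m > 2M.
  have hpt : ∀ ω, Z N ω ≤ M + (1 / (8 * K' * m)) * Z N ω ^ 2 +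
      2 * K' * m * (B M).indicator 1 ω := by
    intro ω
    have ht : 0 < K' * m := by positivity
    by_cases hω : ω ∈ B M
    · have h1 : (1 / (8 * K' * m)) * Z N ω ^ 2 + 2 * (K' * m) - Z N ω =
          (Z N ω - 4 * (K' * m)) ^ 2 / (8 * (K' * m)) := by
        field_simp
        ring
      have h2 : 0 ≤ (Z N ω - 4 * (K' * m)) ^ 2 / (8 * (K' * m)) := by positivity
      have h3 : (0 : ℝ) ≤ M := Nat.cast_nonneg M
      simp only [Set.indicator_of_mem hω, Pi.one_apply]
      linarith
    · have h1 : Z N ω ≤ M := not_lt.1 fun h => hω ⟨N, h⟩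
      have h2 : 0 ≤ (1 / (8 * K' * m)) * Z N ω ^ 2 := by positivity
      simp only [Set.indicator_of_notMem hω]
      linarith
  have hfinal : m ≤ M + (1 / (8 * K' * m)) * ∫ ω, Z N ω ^ 2 ∂μ + 2 * K' * m * μ.real (B M) := by
    have i1 : Integrable (fun _ : Ω => (M : ℝ)) μ := integrable_const _
    have i2 := (hint2 N).const_mul (1 / (8 * K' * m))
    have i3 := (hintS _ (hBm M)).const_mul (2 * K' * m)
    have e1 : ∫ ω, (M : ℝ) + (1 / (8 * K' * m)) * Z N ω ^ 2 +
        2 * K' * m * (B M).indicator 1 ω ∂μ = ∫ ω, (M : ℝ) + (1 / (8 * K' * m)) * Z N ω ^ 2 ∂μ +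
          ∫ ω, 2 * K' * m * (B M).indicator 1 ω ∂μ := integral_add (i1.add i2) i3
    have e2 : ∫ ω, (M : ℝ) + (1 / (8 * K' * m)) * Z N ω ^ 2 ∂μ =
        ∫ _, (M : ℝ) ∂μ + ∫ ω, (1 / (8 * K' * m)) * Z N ω ^ 2 ∂μ := integral_add i1 i2
    have h := integral_mono (hZint N) ((i1.add i2).add i3) hpt
    refine h.trans_eq (e1.trans ?_)
    rw [e2, integral_const_mul, integral_const_mul, integral_indicator_one (hBm M)]
    simp
  have h1 : (1 / (8 * K' * m)) * ∫ ω, Z N ω ^ 2 ∂μ ≤ m / 4 := by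
    refine (mul_le_mul_of_nonneg_left hsm' (by positivity)).trans_eq ?_
    field_simp
    norm_num
  have h2 : 2 * K' * m * μ.real (B M) ≤ m / 4 := by
    refine (mul_le_mul_of_nonneg_left hM.le (by positivity)).trans_eq ?_
    field_simp
    norm_num
  linarith

end SecondMoment

/-! ### Part (b): infinitely many strong cutpoints -/

section Infinite

variable {Ω : Type*} [MeasurableSpace Ω] {μ : Measure Ω} [IsProbabilityMeasure μ] {p : ℕ → ℝ}
  {Y : ℕ → Ω → ℕ}

theorem sum_sum_le_two_mul_of_symm (N : ℕ) {f : ℕ → ℕ → ℝ} (hsymm : ∀ i j, f i j = f j i)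
    (h0 : ∀ i j, 0 ≤ f i j) :
    ∑ i ∈ Finset.range N, ∑ j ∈ Finset.range N, f i j ≤
      2 * ∑ i ∈ Finset.range N, ∑ j ∈ Finset.range N, if i ≤ j then f i j else 0 := by
  have h1 : ∑ i ∈ Finset.range N, ∑ j ∈ Finset.range N, (if i ≤ j then f i j else 0) =
      ∑ i ∈ Finset.range N, ∑ j ∈ Finset.range N, if j ≤ i then f i j else 0 := by
    rw [Finset.sum_comm]
    refine Finset.sum_congr rfl fun i _ => Finset.sum_congr rfl fun j _ => ?_
    rw [hsymm]
  rw [two_mul]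
  nth_rewrite 2 [h1]
  simp only [← Finset.sum_add_distrib]
  refine Finset.sum_le_sum fun i _ => Finset.sum_le_sum fun j _ => ?_
  have := h0 i j
  rcases le_total i j with h | h
  · rw [if_pos h]
    split_ifs <;> linarith
  · rw [if_pos h]
    split_ifs <;> linarith

/-- A harmonic number of index i^2 - i: the cost of nearby pairs, of exactly the order that the
weight 1/log i compensates. -/
theorem sum_inv_sub_le_log (i N : ℕ) (hi : 2 ≤ i) :
    ∑ j ∈ Finset.range N, (if i ≤ j ∧ j < i ^ 2 then 1 / ((j : ℝ) - i + 1) else 0) ≤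
      1 + 2 * Real.log i := by
  calc ∑ j ∈ Finset.range N, (if i ≤ j ∧ j < i ^ 2 then 1 / ((j : ℝ) - i + 1) else 0)
      ≤ ∑ j ∈ Finset.Ico i (i ^ 2), 1 / ((j : ℝ) - i + 1) := by
        rw [← Finset.sum_filter]
        refine Finset.sum_le_sum_of_subset_of_nonneg (fun j hj => ?_) fun j hj _ => ?_
        · exact Finset.mem_Ico.2 (Finset.mem_filter.1 hj).2
        · have : (i : ℝ) ≤ j := by exact_mod_cast (Finset.mem_Ico.1 hj).1
          exact div_nonneg zero_le_one (by linarith)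
    _ = (harmonic (i ^ 2 - i) : ℝ) := by
        rw [Finset.sum_Ico_eq_sum_range, harmonic]
        push_cast
        refine Finset.sum_congr rfl fun k _ => ?_
        rw [one_div]
        congr 1
        ring
    _ ≤ 1 + Real.log ((i ^ 2 - i : ℕ) : ℝ) := by exact_mod_cast harmonic_le_one_add_log _
    _ ≤ 1 + 2 * Real.log i := by
        have h1 : 0 < i ^ 2 - i := by
          have : i < i ^ 2 := by nlinarith
          omega
        have h2 : 2 * Real.log i = Real.log ((i ^ 2 : ℕ) : ℝ) := by
          push_cast; rw [Real.log_pow]; push_cast; ring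
        rw [h2]
        gcongr
        exact Nat.sub_le _ _

/-- Weighted correlation bound for strong cutpoints: beyond `i ^ 2` they are comparable to
independent events. -/
theorem HasLevelMinLaw.measureReal_strongCutEvent_inter_le (hp : NonnegDrift p)
    (hs : Summable (scaleIncr p)) (hY : HasLevelMinLaw p μ Y) {δ : ℝ} (hδ : 0 < δ) {n₀ : ℕ}
    (hD : ∀ n : ℕ, n₀ ≤ n → D p n ≤ δ * (n : ℝ) * Real.log (n : ℝ)) {i j : ℕ} (hi : 2 ≤ i)
    (hi0 : n₀ ≤ i) (hij : i ≤ j) :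
    μ.real (strongCutEvent Y i ∩ strongCutEvent Y j) ≤
      μ.real (strongCutEvent Y i) *
        (1 / (1 - Real.exp (-(Real.log 2 / δ))) * μ.real (strongCutEvent Y j) +
          2 * (if i ≤ j ∧ j < i ^ 2 then 1 / ((j : ℝ) - i + 1) else 0)) := by
  have hexp : Real.exp (-(Real.log 2 / δ)) < 1 := by
    rw [Real.exp_lt_one_iff, neg_lt_zero]
    exact div_pos (Real.log_pos (by norm_num)) hδ
  set C := 1 / (1 - Real.exp (-(Real.log 2 / δ)))
  have hC : 1 ≤ C := by
    rw [le_div_iff₀ (by linarith)]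
    linarith [Real.exp_pos (-(Real.log 2 / δ))]
  have ha : ∀ R, 0 ≤ μ.real (strongCutEvent Y R) := fun R => measureReal_nonneg
  -- The + 1 in the denominator admits the diagonal; off it, the factor 2 pays for it through
  -- 1/(j-i) ≤ 2/(j-i+1).
  rcases hij.eq_or_lt with rfl | hij
  · have h2 : i < i ^ 2 := by nlinarith
    rw [Set.inter_self, if_pos ⟨le_rfl, h2⟩]
    have : 0 ≤ C * μ.real (strongCutEvent Y i) := mul_nonneg (by linarith) (ha i)
    have h3 : 2 * (1 / ((i : ℝ) - i + 1)) = 2 := by norm_num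
    rw [h3]
    nlinarith [ha i]
  have hDi := hp.D_pos hs i
  have hDj := hp.D_pos hs j
  have hEi := hp.E_pos i
  have hEj := hp.E_pos j
  have hF : 0 < DFin p i j := zero_lt_one.trans_le (hp.one_le_DFin hij)
  have heq : μ.real (strongCutEvent Y i ∩ strongCutEvent Y j) =
      μ.real (strongCutEvent Y i) * (μ.real (strongCutEvent Y j) * (D p i / DFin p i j)) := by
    rw [hY.measureReal_strongCutEvent_inter hp hs hij, hY.measureReal_strongCutEvent hp hs,
      hY.measureReal_strongCutEvent hp hs]
    field_simp
  rw [heq]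
  refine mul_le_mul_of_nonneg_left ?_ (ha i)
  by_cases hj : j < i ^ 2
  · rw [if_pos ⟨hij.le, hj⟩]
    have hji : (1 : ℝ) ≤ (j : ℝ) - i := by
      have : (i : ℝ) + 1 ≤ j := by exact_mod_cast hij
      linarith
    refine (mul_le_mul_of_nonneg_left (hp.D_div_DFin_le hs hij) (ha j)).trans ?_
    rw [mul_add, mul_one]
    refine add_le_add (le_mul_of_one_le_left (ha j) hC) ?_
    rw [hY.measureReal_strongCutEvent hp hs, div_mul_div_cancel₀ hDj.ne', mul_one_div,
      div_le_div_iff₀ (by linarith) (by linarith)]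
    have := hp.E_le_one j
    nlinarith
  · rw [if_neg (by tauto), mul_zero, add_zero, mul_comm C]
    exact mul_le_mul_of_nonneg_left
      (hp.D_div_DFin_le_of_sq_le hs hδ hD hi hi0 (not_lt.1 hj)) (ha j)

theorem HasLevelMinLaw.ae_infinite_strongCutEvent (hp : NonnegDrift p)
    (hs : Summable (scaleIncr p)) (hY : HasLevelMinLaw p μ Y) {δ : ℝ} (hδ : 0 < δ) {n₀ : ℕ}
    (hD : ∀ n : ℕ, n₀ ≤ n → D p n ≤ δ * (n : ℝ) * Real.log (n : ℝ))
    (hsum : ¬ Summable fun n : ℕ => 1 / (D p (n + 2) * Real.log ((n + 2 : ℕ) : ℝ))) :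
    ∀ᵐ ω ∂μ, {R | ω ∈ strongCutEvent Y R}.Infinite := by
  let n₁ := max n₀ 2
  let w : ℕ → ℝ := fun R => if n₁ ≤ R then 1 / Real.log R else 0
  let a : ℕ → ℝ := fun R => μ.real (strongCutEvent Y R)
  let C := 1 / (1 - Real.exp (-(Real.log 2 / δ)))
  have ha : ∀ R, 0 ≤ a R := fun R => measureReal_nonneg
  have hw : ∀ R, 0 ≤ w R := fun R => by
    simp only [w]
    split_ifs
    · exact div_nonneg zero_le_one (Real.log_natCast_nonneg R)
    · exact le_rfl
  have hns : ¬ Summable fun R => w R * a R := by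
    intro h
    apply hsum
    have hg : Summable fun n : ℕ => 1 / (D p n * Real.log n) := by
      refine (summable_nat_add_iff n₁).1 (Summable.of_nonneg_of_le (fun n => ?_) (fun n => ?_)
        (((summable_nat_add_iff n₁).2 h).mul_left 2))
      · exact div_nonneg zero_le_one (mul_nonneg (hp.D_pos hs _).le (Real.log_natCast_nonneg _))
      · have h1 := hp.half_le_E (n + n₁)
        have h2 := hp.D_pos hs (n + n₁)
        have h3 : 0 ≤ 1 / (D p (n + n₁) * Real.log ((n + n₁ : ℕ) : ℝ)) :=
          div_nonneg zero_le_one (mul_nonneg h2.le (Real.log_natCast_nonneg _))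
        have h4 : 2 * (w (n + n₁) * a (n + n₁)) =
            2 * E p (n + n₁) * (1 / (D p (n + n₁) * Real.log ((n + n₁ : ℕ) : ℝ))) := by
          simp only [w, a, if_pos (Nat.le_add_left n₁ n), hY.measureReal_strongCutEvent hp hs]
          rw [← one_div_mul_one_div]
          ring
        rw [h4]
        exact le_mul_of_one_le_left h3 (by linarith)
    exact (summable_nat_add_iff 2).2 hg
  have hdiv := (not_summable_iff_tendsto_nat_atTop_of_nonneg
    fun R => mul_nonneg (hw R) (ha R)).1 hns
  have hnot : ¬ ∀ᵐ ω ∂μ, {R | ω ∈ strongCutEvent Y R}.Finite := by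
    refine not_ae_finite_of_second_moment hY.measurableSet_strongCutEvent hw hdiv
      (K := 2 * max C 8 + 16) fun N => ?_
    set m := ∑ R ∈ Finset.range N, w R * μ.real (strongCutEvent Y R)
    have hm0 : 0 ≤ m := Finset.sum_nonneg fun R _ => mul_nonneg (hw R) (ha R)
    -- Weights decrease, so w_j ≤ w_i on the nearby terms; then w_i (1 + 2 log i) ≤ 4 because log i
    -- ≥ 1/2, and doubling gives 8.
    have hrow : ∀ i, ∑ j ∈ Finset.range N, (if i ≤ j then
        w i * w j * μ.real (strongCutEvent Y i ∩ strongCutEvent Y j) else 0) ≤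
        w i * a i * (C * m + 8) := by
      intro i
      by_cases hi : n₁ ≤ i
      · have hi2 : 2 ≤ i := (le_max_right _ _).trans hi
        have hlog2 : 1 / 2 ≤ Real.log 2 := by linarith [Real.log_two_gt_d9]
        have hlogi : 1 / 2 ≤ Real.log i :=
          hlog2.trans (Real.log_le_log (by norm_num) (by exact_mod_cast hi2))
        have hwi : w i = 1 / Real.log i := if_pos hi
        let t : ℕ → ℝ := fun j => if i ≤ j ∧ j < i ^ 2 then 1 / ((j : ℝ) - i + 1) else 0
        have ht0 : ∀ j, 0 ≤ t j := fun j => by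
          simp only [t]
          split_ifs with h
          · have : (i : ℝ) ≤ j := by exact_mod_cast h.1
            exact div_nonneg zero_le_one (by linarith)
          · exact le_rfl
        calc ∑ j ∈ Finset.range N, (if i ≤ j then
              w i * w j * μ.real (strongCutEvent Y i ∩ strongCutEvent Y j) else 0)
            ≤ ∑ j ∈ Finset.range N, w i * a i * (C * (w j * a j) + 2 * (w i * t j)) := by
              have hC0 : 0 ≤ C := by
                refine div_nonneg zero_le_one (sub_nonneg.2 (Real.exp_le_one_iff.2 ?_))
                exact neg_nonpos.2 (div_nonneg (by linarith) hδ.le)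
              refine Finset.sum_le_sum fun j _ => ?_
              split_ifs with hij
              · have hwj : w j ≤ w i := by
                  rw [hwi]
                  simp only [w, if_pos (hi.trans hij)]
                  exact one_div_le_one_div_of_le (by linarith)
                    (Real.log_le_log (by positivity) (by exact_mod_cast hij))
                calc w i * w j * μ.real (strongCutEvent Y i ∩ strongCutEvent Y j)
                    ≤ w i * w j * (a i * (C * a j + 2 * t j)) :=
                      mul_le_mul_of_nonneg_left
                        (hY.measureReal_strongCutEvent_inter_le hp hs hδ hD hi2
                          ((le_max_left _ _).trans hi) hij) (mul_nonneg (hw i) (hw j))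
                  _ = w i * a i * (C * (w j * a j) + 2 * (w j * t j)) := by ring
                  _ ≤ _ := by
                      refine mul_le_mul_of_nonneg_left ?_ (mul_nonneg (hw i) (ha i))
                      have := mul_le_mul_of_nonneg_right hwj (ht0 j)
                      linarith
              · exact mul_nonneg (mul_nonneg (hw i) (ha i)) (add_nonneg
                  (mul_nonneg hC0 (mul_nonneg (hw j) (ha j)))
                  (mul_nonneg zero_le_two (mul_nonneg (hw i) (ht0 j))))
          _ = w i * a i * (C * m + 2 * (w i * ∑ j ∈ Finset.range N, t j)) := by
              rw [← Finset.mul_sum, Finset.sum_add_distrib, ← Finset.mul_sum, ← Finset.mul_sum,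
                ← Finset.mul_sum]
          _ ≤ w i * a i * (C * m + 8) := by
              refine mul_le_mul_of_nonneg_left ?_ (mul_nonneg (hw i) (ha i))
              have h1 : w i * ∑ j ∈ Finset.range N, t j ≤ 4 := by
                rw [hwi, one_div_mul_eq_div, div_le_iff₀ (by linarith)]
                exact (sum_inv_sub_le_log i N hi2).trans (by linarith)
              linarith
      · have hwi : w i = 0 := if_neg hi
        simp [hwi]
    calc ∑ i ∈ Finset.range N, ∑ j ∈ Finset.range N,
          w i * w j * μ.real (strongCutEvent Y i ∩ strongCutEvent Y j)
        ≤ 2 * ∑ i ∈ Finset.range N, ∑ j ∈ Finset.range N, if i ≤ j then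
          w i * w j * μ.real (strongCutEvent Y i ∩ strongCutEvent Y j) else 0 :=
          sum_sum_le_two_mul_of_symm N (fun i j => by rw [Set.inter_comm, mul_comm (w i)])
            fun i j => mul_nonneg (mul_nonneg (hw i) (hw j)) measureReal_nonneg
      _ ≤ 2 * ∑ i ∈ Finset.range N, w i * a i * (C * m + 8) := by
          gcongr with i
          exact hrow i
      _ = 2 * C * m ^ 2 + 16 * m := by rw [← Finset.sum_mul]; ring
      _ ≤ (2 * max C 8 + 16) * (m ^ 2 + m) := by
          have h1 : C ≤ max C 8 := le_max_left _ _
          have h2 : 8 ≤ max C 8 := le_max_right _ _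
          nlinarith [sq_nonneg m]
  rcases hY.strongCutEvent_infinite_zero_one hp with h | h
  · refine absurd ?_ hnot
    filter_upwards [measure_eq_zero_iff_ae_notMem.1 h] with ω hω
    exact Set.not_infinite.1 hω
  · have hm : MeasurableSet {ω | {R | ω ∈ strongCutEvent Y R}.Infinite} := by
      refine (limsup_le_of_le (by isBoundedDefault) (Eventually.of_forall fun s => ?_) :
        limsup (fun s => MeasurableSpace.comap (Y s) inferInstance) atTop ≤ _) _
        measurableSet_limsup_strongCutEvent_infinite
      exact (hY.measurable s).comap_le
    exact (mem_ae_iff_prob_eq_one hm).2 h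

end Infinite

end BirthDeath

theorem theorem1p1 {Ω : Type*} [MeasurableSpace Ω] (μ : Measure Ω) [IsProbabilityMeasure μ]
    (p : ℕ → ℝ) (hp : ∀ i, 1 ≤ i → 0 ≤ p i ∧ p i < 1 / 2)
    (X : ℕ → Ω → ℕ) (hX : BirthDeath.IsMarkovChain μ (BirthDeath.step p) X)
    (htrans : BirthDeath.IsTransient μ X) :
    ((Summable fun n : ℕ => 1 / (BirthDeath.D p (n + 2) * Real.log ((n + 2 : ℕ) : ℝ))) →
      ∀ᵐ ω ∂μ, {R : ℕ | BirthDeath.IsCutpoint (fun k => X k ω) R}.Finite) ∧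
    ((∃ δ : ℝ, 0 < δ ∧ ∃ n₀ : ℕ, ∀ n : ℕ, n₀ ≤ n →
        BirthDeath.D p n ≤ δ * (n : ℝ) * Real.log (n : ℝ)) →
      (¬ Summable fun n : ℕ => 1 / (BirthDeath.D p (n + 2) * Real.log ((n + 2 : ℕ) : ℝ))) →
      ∀ᵐ ω ∂μ, {R : ℕ | BirthDeath.IsStrongCutpoint (fun k => X k ω) R}.Infinite) := by
  have hp' : BirthDeath.NonnegDrift p := hp
  have hY := hX.hasLevelMinLaw hp'
  have hs := hX.summable_scaleIncr hp' htrans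
  constructor
  · intro hsum
    filter_upwards [hY.ae_finite_cutEvent hp' hs hsum, hX.ae_isUnboundedPath hp'] with ω h1 h2
    refine h1.subset fun R hR => h2.isCutpoint_iff.1 hR
  · rintro ⟨δ, hδ, n₀, hD⟩ hsum
    filter_upwards [hY.ae_infinite_strongCutEvent hp' hs hδ hD hsum,
      hX.ae_isUnboundedPath hp'] with ω h1 h2
    exact h1.mono fun R hR => h2.isStrongCutpoint_iff.2 hR
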